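/- Let $k$ be a field of characteristic zero. For a $\mathbb{Z}$-graded $k$-vector space $\mathcal{H}=\bigoplus_{d\in\mathbb{Z}}\mathcal{H}^d$ let $C(\mathcal{H})=\bigoplus_{n\ge 0}\mathcal{H}^{\otimes n}$ be its tensor coalgebra, with the coproduct $\triangle(o_1\cdots o_n)=\sum_{i=0}^{n}(o_1\cdots o_i)\otimes(o_{i+1}\cdots o_n)$ and graded by total degree. An $A_\infty$-algebra $(\mathcal{H},\mathfrak{m})$ is such an $\mathcal{H}$ with a linear map $\mathfrak{m}:C(\mathcal{H})\to C(\mathcal{H})$ of degree one that is a coderivation, $\triangle\mathfrak{m}=(\mathfrak{m}\otimes 1+1\otimes\mathfrak{m})\triangle$ where $(1\otimes\mathfrak{m})(x\otimes y)=(-1)^{|x|}x\otimes\mathfrak{m}(y)$, and satisfies $\mathfrak{m}^2=0$ and $m_0=0$; here $m_n:\mathcal{H}^{\otimes n}\to\mathcal{H}$ is the restriction of $\mathfrak{m}$ to $\mathcal{H}^{\otimes n}$ followed by the projection to $\mathcal{H}^{\otimes 1}=\mathcal{H}$. An $A_\infty$-morphism $(\mathcal{H},\mathfrak{m})\to(\mathcal{H}',\mathfrak{m}')$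 is a (counital) coalgebra homomorphism $\mathcal{F}:C(\mathcal{H})\to C(\mathcal{H}')$ of degree zero with $\mathcal{F}\mathfrak{m}=\mathfrak{m}'\mathcal{F}$ and $f_0=0$, where the components $f_n:\mathcal{H}^{\otimes n}\to\mathcal{H}'$ are defined in the same way; it is an $A_\infty$-isomorphism if $f_1:\mathcal{H}\to\mathcal{H}'$ is an isomorphism. An $A_\infty$-algebra is minimal if $m_1=0$, and linear contractible if $m_n=0$ for all $n\ge 2$ and the complex $(\mathcal{H},m_1)$ has trivial cohomology. The direct sum of $(\mathcal{H},\mathfrak{m})$ and $(\mathcal{H}',\mathfrak{m}')$ is the $A_\infty$-algebra on $\mathcal{H}\oplus\mathcal{H}'$ whose operations are $((x_1,y_1),\dots,(x_n,y_n))\mapsto(m_n(x_1,\dots,x_n),m'_n(y_1,\dots,y_n))$. **Theorem (Decomposition theorem for $A_\infty$-algebras).** Every $A_\infty$-algebra over $k$ is $A_\infty$-isomorphic to the direct sum of a minimal $A_\infty$-algebra and a linear contractible $A_\infty$-algebra. -/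

import Mathlib

open scoped TensorProduct DirectSum

universe u u' v

noncomputable section

namespace AInfinity

section Deconcatenation

variable (k : Type v) [Field k] (V : Type u) [AddCommGroup V] [Module k V]

/-- Left multiplication by a letter `v`, together with its effect on the deconcatenation
coproduct: `(w, d) ↦ (v w, 1 ⊗ v w + (v ⊗ 1) d)`. -/
def deconcatStep :
    V →ₗ[k] Module.End k
      (TensorAlgebra k V × (TensorAlgebra k V ⊗[k] TensorAlgebra k V)) where
  toFun v :=
    ((LinearMap.mulLeft k (TensorAlgebra.ι k v)) ∘ₗ LinearMap.fst k _ _).prod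
      ((TensorProduct.mk k _ _ 1) ∘ₗ (LinearMap.mulLeft k (TensorAlgebra.ι k v)) ∘ₗ
          LinearMap.fst k _ _ +
        (LinearMap.mulLeft k (TensorAlgebra.ι k v ⊗ₜ[k] (1 : TensorAlgebra k V))) ∘ₗ
          LinearMap.snd k _ _)
  map_add' v w := by
    refine LinearMap.ext fun x => Prod.ext ?_ ?_
    · simp [add_mul]
    · simp [add_mul, TensorProduct.add_tmul, TensorProduct.tmul_add]
      abel
  map_smul' c v := by
    refine LinearMap.ext fun x => Prod.ext ?_ ?_
    · simp
    · simp [← TensorProduct.smul_tmul']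

theorem deconcatStep_apply (v : V)
    (x : TensorAlgebra k V × (TensorAlgebra k V ⊗[k] TensorAlgebra k V)) :
    deconcatStep k V v x = (TensorAlgebra.ι k v * x.1,
      1 ⊗ₜ[k] (TensorAlgebra.ι k v * x.1) + (TensorAlgebra.ι k v ⊗ₜ[k] 1) * x.2) := rfl

/-- The deconcatenation coproduct on the tensor coalgebra `C(V) = ⨁ₙ V^{⊗n}`, whose underlying
vector space is that of `TensorAlgebra k V`:
`Δ(v₁ ⋯ vₙ) = ∑ᵢ (v₁ ⋯ vᵢ) ⊗ (vᵢ₊₁ ⋯ vₙ)` for `0 ≤ i ≤ n` (see `deconcat_prod`). -/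
def deconcat : TensorAlgebra k V →ₗ[k] TensorAlgebra k V ⊗[k] TensorAlgebra k V :=
  LinearMap.snd k _ _ ∘ₗ
    LinearMap.applyₗ ((1 : TensorAlgebra k V), (1 : TensorAlgebra k V) ⊗ₜ[k] 1) ∘ₗ
      (TensorAlgebra.lift k (deconcatStep k V)).toLinearMap

theorem deconcat_one : deconcat k V 1 = 1 ⊗ₜ[k] 1 := by
  simp [deconcat]

theorem deconcat_ι_mul (v : V) (w : TensorAlgebra k V) :
    deconcat k V (TensorAlgebra.ι k v * w) =
      1 ⊗ₜ[k] (TensorAlgebra.ι k v * w) + (TensorAlgebra.ι k v ⊗ₜ[k] 1) * deconcat k V w := by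
  have hfst : ∀ w : TensorAlgebra k V,
      (TensorAlgebra.lift k (deconcatStep k V) w
        ((1 : TensorAlgebra k V), (1 : TensorAlgebra k V) ⊗ₜ[k] 1)).1 = w := by
    intro w
    have key : ∀ (w : TensorAlgebra k V) x,
        (TensorAlgebra.lift k (deconcatStep k V) w x).1 = w * x.1 := by
      intro w
      induction w using TensorAlgebra.induction with
      | algebraMap r => intro x; simp [Algebra.smul_def]
      | ι v => intro x; simp [deconcatStep_apply]
      | mul a b ha hb => intro x; simp [ha, hb, mul_assoc]
      | add a b ha hb => intro x; simp [ha, hb, add_mul]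
    simp [key]
  simp only [deconcat, LinearMap.comp_apply, AlgHom.toLinearMap_apply, map_mul,
    TensorAlgebra.lift_ι_apply, LinearMap.applyₗ_apply_apply, Module.End.mul_apply]
  simp [deconcatStep_apply, hfst]

theorem deconcat_prod (l : List V) :
    deconcat k V (l.map (TensorAlgebra.ι k)).prod =
      ∑ i ∈ Finset.range (l.length + 1),
        ((l.take i).map (TensorAlgebra.ι k)).prod ⊗ₜ[k]
          ((l.drop i).map (TensorAlgebra.ι k)).prod := by
  induction l with
  | nil => simp [deconcat_one]
  | cons v l ih =>
    rw [List.map_cons, List.prod_cons, deconcat_ι_mul, ih, List.length_cons,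
      Finset.sum_range_succ' _ (l.length + 1), Finset.mul_sum, add_comm]
    simp

end Deconcatenation

section Graded

variable (k : Type v) [Field k] (H : ℤ → Type u) [∀ d, AddCommGroup (H d)] [∀ d, Module k (H d)]

/-- The tensor coalgebra `C(H)` of the graded vector space `H = ⨁ d, H d`. -/
abbrev TensorCoalg : Type (max u v) := TensorAlgebra k (⨁ d, H d)

/-- The part of `C(H)` of total degree `d`, spanned by the words `o₁ ⋯ oₙ` in homogeneous
letters whose degrees add up to `d`. -/
def tensorDegree (d : ℤ) : Submodule k (TensorCoalg k H) :=
  Submodule.span k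
    {x | ∃ (n : ℕ) (e : Fin n → ℤ) (o : ∀ i, H (e i)), ∑ i, e i = d ∧
      x = TensorAlgebra.tprod k (⨁ d, H d) n (fun i => DirectSum.lof k ℤ H (e i) (o i))}

/-- The map of `C(H)` that multiplies the part of total degree `d` by `(-1)^d`. -/
def koszulSign : TensorCoalg k H →ₗ[k] TensorCoalg k H :=
  (TensorAlgebra.lift k ((TensorAlgebra.ι k) ∘ₗ
    DirectSum.lmap (fun d : ℤ => d.negOnePow • (LinearMap.id : H d →ₗ[k] H d))
      )).toLinearMap

variable {k H}

/-- `n`-ary component `H^{⊗n} → H'` of a linear map between tensor coalgebras: restrict to words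
of length `n`, and project to words of length one. -/
def component {H' : ℤ → Type u'} [∀ d, AddCommGroup (H' d)] [∀ d, Module k (H' d)]
    (F : TensorCoalg k H →ₗ[k] TensorCoalg k H') (n : ℕ) :
    MultilinearMap k (fun _ : Fin n => ⨁ d, H d) (⨁ d, H' d) :=
  (TensorAlgebra.ιInv ∘ₗ F).compMultilinearMap (TensorAlgebra.tprod k (⨁ d, H d) n)

end Graded

/-- An `A∞`-algebra on the `ℤ`-graded vector space `H`: a degree one coderivation `𝔪` of the
tensor coalgebra `C(H)` with `𝔪² = 0` and `m₀ = 0`. In `coderivation`, the operator `1 ⊗ 𝔪`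
carries the Koszul sign `(1 ⊗ 𝔪)(x ⊗ y) = (-1)^{|x|} x ⊗ 𝔪 y`. -/
structure AInfinityAlgebra (k : Type v) [Field k] (H : ℤ → Type u)
    [∀ d, AddCommGroup (H d)] [∀ d, Module k (H d)] where
  codiff : TensorCoalg k H →ₗ[k] TensorCoalg k H
  degree_one : ∀ (d : ℤ), ∀ x ∈ tensorDegree k H d, codiff x ∈ tensorDegree k H (d + 1)
  coderivation : deconcat k (⨁ d, H d) ∘ₗ codiff =
    (TensorProduct.map codiff LinearMap.id + TensorProduct.map (koszulSign k H) codiff) ∘ₗ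
      deconcat k (⨁ d, H d)
  sq_zero : codiff ∘ₗ codiff = 0
  component_zero : component codiff 0 = 0

namespace AInfinityAlgebra

variable {k : Type v} [Field k]
  {H : ℤ → Type u} [∀ d, AddCommGroup (H d)] [∀ d, Module k (H d)]
  {H' : ℤ → Type u'} [∀ d, AddCommGroup (H' d)] [∀ d, Module k (H' d)]

/-- The multilinear operation `mₙ`. -/
def m (X : AInfinityAlgebra k H) (n : ℕ) :
    MultilinearMap k (fun _ : Fin n => ⨁ d, H d) (⨁ d, H d) :=
  component X.codiff n

/-- `m₁ = 0`. -/
def IsMinimal (X : AInfinityAlgebra k H) : Prop :=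
  X.m 1 = 0

/-- `mₙ = 0` for `n ≥ 2`, and the complex `(H, m₁)` has trivial cohomology. -/
def IsLinearContractible (X : AInfinityAlgebra k H) : Prop :=
  (∀ n, 2 ≤ n → X.m n = 0) ∧
    ∀ x : ⨁ d, H d, X.m 1 (fun _ => x) = 0 → ∃ y : ⨁ d, H d, X.m 1 (fun _ => y) = x

/-- `S` is the direct sum of `X` and `Y`: its underlying graded space is the degreewise direct
sum, and `mₙ((x₁, y₁), …, (xₙ, yₙ)) = (mₙ(x₁, …, xₙ), mₙ(y₁, …, yₙ))` for all `n`. -/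
def IsDirectSum (S : AInfinityAlgebra k (fun d => H d × H' d))
    (X : AInfinityAlgebra k H) (Y : AInfinityAlgebra k H') : Prop :=
  ∀ (n : ℕ) (o : Fin n → ⨁ d, H d × H' d),
    DirectSum.lmap (fun d => LinearMap.fst k (H d) (H' d)) (S.m n o) =
        X.m n (fun i => DirectSum.lmap (fun d => LinearMap.fst k (H d) (H' d)) (o i)) ∧
      DirectSum.lmap (fun d => LinearMap.snd k (H d) (H' d)) (S.m n o) =
        Y.m n (fun i => DirectSum.lmap (fun d => LinearMap.snd k (H d) (H' d)) (o i))

end AInfinityAlgebra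

/-- An `A∞`-morphism: a degree zero (counital) homomorphism of tensor coalgebras that commutes
with the codifferentials and has `f₀ = 0`. -/
structure AInfinityMorphism {k : Type v} [Field k]
    {H : ℤ → Type u} [∀ d, AddCommGroup (H d)] [∀ d, Module k (H d)]
    {H' : ℤ → Type u'} [∀ d, AddCommGroup (H' d)] [∀ d, Module k (H' d)]
    (X : AInfinityAlgebra k H) (Y : AInfinityAlgebra k H') where
  toLinearMap : TensorCoalg k H →ₗ[k] TensorCoalg k H'
  degree_zero : ∀ (d : ℤ), ∀ x ∈ tensorDegree k H d, toLinearMap x ∈ tensorDegree k H' d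
  counit_comp : ∀ x, TensorAlgebra.algebraMapInv (toLinearMap x) =
    TensorAlgebra.algebraMapInv x
  deconcat_comp : deconcat k (⨁ d, H' d) ∘ₗ toLinearMap =
    TensorProduct.map toLinearMap toLinearMap ∘ₗ deconcat k (⨁ d, H d)
  comm : toLinearMap ∘ₗ X.codiff = Y.codiff ∘ₗ toLinearMap
  component_zero : component toLinearMap 0 = 0

namespace AInfinityMorphism

variable {k : Type v} [Field k]
  {H : ℤ → Type u} [∀ d, AddCommGroup (H d)] [∀ d, Module k (H d)]
  {H' : ℤ → Type u'} [∀ d, AddCommGroup (H' d)] [∀ d, Module k (H' d)]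
  {X : AInfinityAlgebra k H} {Y : AInfinityAlgebra k H'}

/-- The multilinear component `fₙ`. -/
def f (F : AInfinityMorphism X Y) (n : ℕ) :
    MultilinearMap k (fun _ : Fin n => ⨁ d, H d) (⨁ d, H' d) :=
  component F.toLinearMap n

/-- `F` is an `A∞`-isomorphism: the linear map `f₁ : H → H'` is an isomorphism. -/
def IsIso (F : AInfinityMorphism X Y) : Prop :=
  Function.Bijective (fun x : ⨁ d, H d => F.f 1 (fun _ => x))

end AInfinityMorphism

end AInfinity

end

/-!
Over a field the complex `(H, m₁)` splits as `A ⊕ B`, with zero differential on `A` and `B`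
contractible, by a contraction `h`. The tensor trick extends this contraction to `C(H)`, and the
homological perturbation lemma, with the higher operations as perturbation, produces a minimal
structure on `A` together with an `A∞`-morphism `q` onto it. The projection `b` onto `B` extends to
an `A∞`-morphism `r` onto the complex `B`, because `j b = d h + h d` is null-homotopic. Coalgebra
homomorphisms into a tensor coalgebra are determined by their corestrictions, so `q` and `r`
together define a coalgebra homomorphism `C(H) → C(A ⊕ B)`; its linear part is the isomorphism
`(p, b)`, hence it is invertible, and it transports the structure of `H` to the direct sum of `A`
and `B`.
-/

noncomputable section

namespace AInfinity

open TensorAlgebra (ι ιInv algebraMapInv)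

section TensorAlgebra

variable {k : Type v} [CommSemiring k] {V : Type u} [AddCommMonoid V] [Module k V]
  {W : Type u'} [AddCommMonoid W] [Module k W] {U : Type*} [AddCommMonoid U] [Module k U]

theorem ι_mul_induction {C : TensorAlgebra k V → Prop} (one : C 1)
    (add : ∀ x y, C x → C y → C (x + y)) (smul : ∀ (c : k) x, C x → C (c • x))
    (ι_mul : ∀ a x, C x → C (ι k a * x)) (x : TensorAlgebra k V) : C x := by
  suffices h : ∀ y, C y → C (x * y) by simpa using h 1 one
  induction x using TensorAlgebra.induction with
  | algebraMap r => intro y hy; rw [← Algebra.smul_def]; exact smul r y hy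
  | ι a => exact ι_mul a
  | mul a b ha hb => intro y hy; rw [mul_assoc]; exact ha _ (hb y hy)
  | add a b ha hb => intro y hy; rw [add_mul]; exact add _ _ (ha y hy) (hb y hy)

theorem linearMap_ext_ι_mul {M : Type*} [AddCommMonoid M] [Module k M]
    {f g : TensorAlgebra k V →ₗ[k] M} (one : f 1 = g 1)
    (ι_mul : ∀ a x, f x = g x → f (ι k a * x) = g (ι k a * x)) : f = g := by
  ext x
  induction x using ι_mul_induction with
  | one => exact one
  | add x y hx hy => rw [map_add, map_add, hx, hy]
  | smul c x hx => rw [map_smul, map_smul, hx]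
  | ι_mul a x hx => exact ι_mul a x hx

@[simp] theorem algebraMapInv_ι_mul (a : V) (x : TensorAlgebra k V) :
    algebraMapInv (ι k a * x) = 0 := by
  simp [algebraMapInv]

@[simp] theorem ιInv_ι (a : V) : ιInv (ι k a) = a := TensorAlgebra.ι_leftInverse a

@[simp] theorem ιInv_one : ιInv (1 : TensorAlgebra k V) = 0 := by
  let : Module kᵐᵒᵖ V := Module.compHom _ ((RingHom.id k).fromOpposite mul_comm)
  have : IsCentralScalar k V := ⟨fun r m => rfl⟩
  simp [ιInv]

@[simp] theorem ιInv_ι_mul (a : V) (x : TensorAlgebra k V) :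
    ιInv (ι k a * x) = algebraMapInv x • a := by
  let : Module kᵐᵒᵖ V := Module.compHom _ ((RingHom.id k).fromOpposite mul_comm)
  have : IsCentralScalar k V := ⟨fun r m => rfl⟩
  have fst_toTrivSqZeroExt : (TrivSqZeroExt.fstHom k k V).comp TensorAlgebra.toTrivSqZeroExt =
      (algebraMapInv : TensorAlgebra k V →ₐ[k] k) := by
    ext a
    simp [algebraMapInv]
  rw [← fst_toTrivSqZeroExt]
  simp [ιInv]

/-- The algebra map `v₁ ⋯ vₙ ↦ g v₁ ⋯ g vₙ` of tensor algebras induced by `g`. -/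
def tmap (g : V →ₗ[k] W) : TensorAlgebra k V →ₐ[k] TensorAlgebra k W :=
  TensorAlgebra.lift k (ι k ∘ₗ g)

@[simp] theorem tmap_ι (g : V →ₗ[k] W) (a : V) : tmap g (ι k a) = ι k (g a) := by
  simp [tmap]

theorem tmap_comp (g : W →ₗ[k] U) (f : V →ₗ[k] W) : tmap (g ∘ₗ f) = (tmap g).comp (tmap f) := by
  ext; simp

theorem tmap_tmap (g : W →ₗ[k] U) (f : V →ₗ[k] W) (x : TensorAlgebra k V) :
    tmap g (tmap f x) = tmap (g ∘ₗ f) x := by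
  rw [tmap_comp, AlgHom.comp_apply]

@[simp] theorem tmap_id : tmap (LinearMap.id : V →ₗ[k] V) = AlgHom.id k _ := by
  ext; simp

@[simp] theorem algebraMapInv_tmap (g : V →ₗ[k] W) (x : TensorAlgebra k V) :
    algebraMapInv (tmap g x) = algebraMapInv x := by
  have : algebraMapInv.comp (tmap g) = algebraMapInv := by ext; simp [algebraMapInv]
  exact DFunLike.congr_fun this x

@[simp] theorem ιInv_tmap (g : V →ₗ[k] W) (x : TensorAlgebra k V) :
    ιInv (tmap g x) = g (ιInv x) := by
  have : ιInv ∘ₗ (tmap g).toLinearMap = g ∘ₗ ιInv :=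
    linearMap_ext_ι_mul (by simp) fun a x _ => by simp
  exact LinearMap.congr_fun this x

end TensorAlgebra

section Deconcatenation

variable {k : Type v} [Field k] {V : Type u} [AddCommGroup V] [Module k V]
  {M : Type*} [AddCommGroup M] [Module k M] {N : Type*} [AddCommGroup N] [Module k N]

theorem ι_tmul_one_mul (a : V) (z : TensorAlgebra k V ⊗[k] TensorAlgebra k V) :
    (ι k a ⊗ₜ[k] (1 : TensorAlgebra k V)) * z =
      (LinearMap.mulLeft k (ι k a)).rTensor (TensorAlgebra k V) z := by
  induction z with
  | zero => simp
  | tmul x y => simp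
  | add x y hx hy => rw [mul_add, map_add, hx, hy]

theorem map_deconcat_ι_mul (E : TensorAlgebra k V →ₗ[k] M) (F : TensorAlgebra k V →ₗ[k] N)
    (a : V) (x : TensorAlgebra k V) :
    TensorProduct.map E F (deconcat k V (ι k a * x)) =
      E 1 ⊗ₜ[k] F (ι k a * x) +
        TensorProduct.map (E ∘ₗ LinearMap.mulLeft k (ι k a)) F (deconcat k V x) := by
  rw [deconcat_ι_mul, ι_tmul_one_mul, map_add, TensorProduct.map_tmul, LinearMap.map_rTensor]

theorem rTensor_counit_deconcat (x : TensorAlgebra k V) :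
    algebraMapInv.toLinearMap.rTensor (TensorAlgebra k V) (deconcat k V x) = (1 : k) ⊗ₜ[k] x := by
  suffices h : algebraMapInv.toLinearMap.rTensor (TensorAlgebra k V) ∘ₗ deconcat k V =
      TensorProduct.mk k k (TensorAlgebra k V) 1 from LinearMap.congr_fun h x
  refine linearMap_ext_ι_mul (by simp [deconcat_one]) fun a x _ => ?_
  have counit_mulLeft : (algebraMapInv (R := k) (M := V)).toLinearMap ∘ₗ
      LinearMap.mulLeft k (ι k a) = 0 := by ext; simp
  simp [LinearMap.rTensor, map_deconcat_ι_mul, counit_mulLeft]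

theorem lTensor_counit_deconcat (x : TensorAlgebra k V) :
    algebraMapInv.toLinearMap.lTensor (TensorAlgebra k V) (deconcat k V x) = x ⊗ₜ[k] (1 : k) := by
  suffices h : algebraMapInv.toLinearMap.lTensor (TensorAlgebra k V) ∘ₗ deconcat k V =
      (TensorProduct.mk k (TensorAlgebra k V) k).flip 1 from LinearMap.congr_fun h x
  refine linearMap_ext_ι_mul (by simp [deconcat_one]) fun a x hx => ?_
  simp only [LinearMap.comp_apply, LinearMap.flip_apply, TensorProduct.mk_apply] at hx ⊢
  rw [LinearMap.lTensor, map_deconcat_ι_mul, LinearMap.id_comp, ← LinearMap.rTensor_comp_lTensor,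
    LinearMap.comp_apply, hx]
  simp

theorem assoc_deconcat (x : TensorAlgebra k V) :
    TensorProduct.assoc k _ _ _ ((deconcat k V).rTensor _ (deconcat k V x)) =
      (deconcat k V).lTensor _ (deconcat k V x) := by
  suffices h : (TensorProduct.assoc k _ _ _).toLinearMap ∘ₗ (deconcat k V).rTensor _ ∘ₗ
      deconcat k V = (deconcat k V).lTensor _ ∘ₗ deconcat k V from LinearMap.congr_fun h x
  refine linearMap_ext_ι_mul (by simp [deconcat_one]) fun a x hx => ?_
  set L := LinearMap.mulLeft k (ι k a)
  have deconcat_mulLeft : deconcat k V ∘ₗ L =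
      TensorProduct.mk k _ _ 1 ∘ₗ L + L.rTensor _ ∘ₗ deconcat k V := by
    ext y
    simp [L, deconcat_ι_mul, ι_tmul_one_mul]
  have assoc_mk : (TensorProduct.assoc k _ _ _).toLinearMap ∘ₗ
      (TensorProduct.mk k _ _ (1 : TensorAlgebra k V) ∘ₗ L).rTensor (TensorAlgebra k V) =
      TensorProduct.mk k _ _ 1 ∘ₗ L.rTensor (TensorAlgebra k V) :=
    TensorProduct.ext' fun _ _ => rfl
  have assoc_rTensor : (TensorProduct.assoc k _ _ _).toLinearMap ∘ₗ
      (L.rTensor (TensorAlgebra k V)).rTensor (TensorAlgebra k V) =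
      L.rTensor _ ∘ₗ (TensorProduct.assoc k _ _ _).toLinearMap :=
    TensorProduct.ext_threefold fun _ _ _ => rfl
  have hleft := LinearMap.congr_fun assoc_mk (deconcat k V x)
  have hright := LinearMap.congr_fun assoc_rTensor ((deconcat k V).rTensor _ (deconcat k V x))
  simp only [LinearMap.comp_apply, LinearEquiv.coe_coe] at hx hleft hright ⊢
  rw [LinearMap.rTensor, map_deconcat_ι_mul, deconcat_mulLeft, ← LinearMap.rTensor,
    LinearMap.rTensor_add, LinearMap.add_apply, map_add, map_add, hleft, LinearMap.rTensor_comp,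
    LinearMap.comp_apply, hright, hx, LinearMap.lTensor, map_deconcat_ι_mul, LinearMap.id_comp,
    deconcat_ι_mul, ι_tmul_one_mul]
  simp [deconcat_one, TensorProduct.tmul_add, add_assoc, L, LinearMap.rTensor,
    TensorProduct.map_map]

/-- Course-of-values induction on words: `lTensor E (Δ x)` records the values of `E` at all
terminal segments of `x`. -/
theorem linearMap_ext_deconcat {E F : TensorAlgebra k V →ₗ[k] M} (one : E 1 = F 1)
    (ι_mul : ∀ a x, E.lTensor (TensorAlgebra k V) (deconcat k V x) =
      F.lTensor (TensorAlgebra k V) (deconcat k V x) → E (ι k a * x) = F (ι k a * x)) :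
    E = F := by
  have h : E.lTensor (TensorAlgebra k V) ∘ₗ deconcat k V = F.lTensor _ ∘ₗ deconcat k V := by
    refine linearMap_ext_ι_mul (by simp [deconcat_one, one]) fun a x hx => ?_
    simp only [LinearMap.comp_apply] at hx ⊢
    rw [LinearMap.lTensor, LinearMap.lTensor, map_deconcat_ι_mul, map_deconcat_ι_mul,
      LinearMap.id_comp, ← LinearMap.rTensor_comp_lTensor, ← LinearMap.rTensor_comp_lTensor,
      LinearMap.comp_apply, LinearMap.comp_apply, hx, ι_mul a x hx]
  have counit_left : ∀ (G : TensorAlgebra k V →ₗ[k] M) x, TensorProduct.lid k M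
      (algebraMapInv.toLinearMap.rTensor M (G.lTensor _ (deconcat k V x))) = G x := fun G x => by
    rw [← LinearMap.comp_apply (LinearMap.rTensor _ _), LinearMap.rTensor_comp_lTensor,
      ← LinearMap.lTensor_comp_rTensor, LinearMap.comp_apply, rTensor_counit_deconcat]
    simp
  ext x
  rw [← counit_left E, ← counit_left F, ← LinearMap.comp_apply (E.lTensor _), h,
    LinearMap.comp_apply]

/-- Splitting off the first letter: `v₁ ⋯ vₙ = v₁ · (v₂ ⋯ vₙ)` is the only term of the
deconcatenation that survives `ι ∘ ιInv` on the left-hand factor. -/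
theorem eq_counit_add_first_letter (x : TensorAlgebra k V) :
    x = algebraMap k _ (algebraMapInv x) + LinearMap.mul' k _
      ((ι k ∘ₗ ιInv).rTensor (TensorAlgebra k V) (deconcat k V x)) := by
  suffices h : LinearMap.id = (Algebra.linearMap k _ ∘ₗ algebraMapInv.toLinearMap) +
      LinearMap.mul' k (TensorAlgebra k V) ∘ₗ
        (ι k ∘ₗ ιInv).rTensor (TensorAlgebra k V) ∘ₗ deconcat k V from LinearMap.congr_fun h x
  refine linearMap_ext_ι_mul (by simp [deconcat_one]) fun a x _ => ?_
  have first_letter : (ι k ∘ₗ ιInv) ∘ₗ LinearMap.mulLeft k (ι k a) =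
      LinearMap.toSpanSingleton k _ (ι k a) ∘ₗ algebraMapInv.toLinearMap := by ext; simp
  simp only [LinearMap.add_apply, LinearMap.comp_apply]
  rw [LinearMap.rTensor, map_deconcat_ι_mul, first_letter, ← LinearMap.rTensor,
    LinearMap.rTensor_comp_apply, rTensor_counit_deconcat]
  simp

end Deconcatenation

section CoalgHom

variable {k : Type v} [Field k] {V : Type u} [AddCommGroup V] [Module k V]
  {W : Type u'} [AddCommGroup W] [Module k W] {U : Type*} [AddCommGroup U] [Module k U]

theorem map_sub_left {M N P Q : Type*} [AddCommGroup M] [AddCommGroup N] [AddCommGroup P]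
    [AddCommGroup Q] [Module k M] [Module k N] [Module k P] [Module k Q] (f f' : M →ₗ[k] P)
    (g : N →ₗ[k] Q) :
    TensorProduct.map (f - f') g = TensorProduct.map f g - TensorProduct.map f' g :=
  (TensorProduct.mapBilinear _ _ _ _ _).map_sub₂ f f' g

theorem map_sub_right {M N P Q : Type*} [AddCommGroup M] [AddCommGroup N] [AddCommGroup P]
    [AddCommGroup Q] [Module k M] [Module k N] [Module k P] [Module k Q] (f : M →ₗ[k] P)
    (g g' : N →ₗ[k] Q) :
    TensorProduct.map f (g - g') = TensorProduct.map f g - TensorProduct.map f g' :=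
  map_sub (TensorProduct.mapBilinear _ _ _ _ _ f) g g'

/-- A counital homomorphism of tensor coalgebras. -/
structure IsCoalgHom (F : TensorAlgebra k V →ₗ[k] TensorAlgebra k W) : Prop where
  counit_apply : ∀ x, algebraMapInv (F x) = algebraMapInv x
  deconcat_apply : ∀ x, deconcat k W (F x) = TensorProduct.map F F (deconcat k V x)

/-- A `(G, F)`-coderivation of tensor coalgebras: `Δ E = (E ⊗ F + G ⊗ E) Δ`. The coderivations of
an `A∞`-algebra are the case `G = koszulSign`, `F = id`. -/
def IsCoderivation (G F E : TensorAlgebra k V →ₗ[k] TensorAlgebra k W) : Prop :=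
  ∀ x, deconcat k W (E x) =
    TensorProduct.map E F (deconcat k V x) + TensorProduct.map G E (deconcat k V x)

theorem isCoalgHom_tmap (g : V →ₗ[k] W) : IsCoalgHom (tmap g).toLinearMap := by
  refine ⟨algebraMapInv_tmap g, LinearMap.congr_fun (f := deconcat k W ∘ₗ (tmap g).toLinearMap)
    (g := TensorProduct.map _ _ ∘ₗ deconcat k V) ?_⟩
  refine linearMap_ext_ι_mul (by simp [deconcat_one]) fun a x hx => ?_
  have tmap_mulLeft : (tmap g).toLinearMap ∘ₗ LinearMap.mulLeft k (ι k a) =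
      LinearMap.mulLeft k (ι k (g a)) ∘ₗ (tmap g).toLinearMap := by ext; simp
  simp only [LinearMap.comp_apply, AlgHom.toLinearMap_apply] at hx ⊢
  rw [map_deconcat_ι_mul, tmap_mulLeft, ← LinearMap.rTensor_map, ← hx, map_mul, tmap_ι,
    deconcat_ι_mul, ι_tmul_one_mul]
  simp

namespace IsCoalgHom

variable {F G : TensorAlgebra k V →ₗ[k] TensorAlgebra k W}

theorem comp {Q : TensorAlgebra k W →ₗ[k] TensorAlgebra k U} (hQ : IsCoalgHom Q)
    (hF : IsCoalgHom F) : IsCoalgHom (Q ∘ₗ F) where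
  counit_apply x := (hQ.counit_apply _).trans (hF.counit_apply x)
  deconcat_apply x := by
    rw [LinearMap.comp_apply, hQ.deconcat_apply, hF.deconcat_apply, TensorProduct.map_map]

theorem map_one (hF : IsCoalgHom F) (h : ιInv (F 1) = 0) : F 1 = 1 := by
  rw [eq_counit_add_first_letter (F 1), hF.counit_apply, hF.deconcat_apply, deconcat_one]
  simp [h]

theorem isCoderivation_sub (hF : IsCoalgHom F) (hG : IsCoalgHom G) :
    IsCoderivation G F (F - G) := fun x => by
  rw [LinearMap.sub_apply, map_sub, hF.deconcat_apply, hG.deconcat_apply,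
    map_sub_left, map_sub_right]
  simp

end IsCoalgHom

namespace IsCoderivation

variable {G F E E' : TensorAlgebra k V →ₗ[k] TensorAlgebra k W}

theorem sub (hE : IsCoderivation G F E) (hE' : IsCoderivation G F E') :
    IsCoderivation G F (E - E') := fun x => by
  rw [LinearMap.sub_apply, map_sub, hE, hE', map_sub_left,
    map_sub_right, LinearMap.sub_apply, LinearMap.sub_apply]
  abel

theorem comp_isCoalgHom (hE : IsCoderivation G F E)
    {Q : TensorAlgebra k U →ₗ[k] TensorAlgebra k V} (hQ : IsCoalgHom Q) :
    IsCoderivation (G ∘ₗ Q) (F ∘ₗ Q) (E ∘ₗ Q) := fun x => by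
  rw [LinearMap.comp_apply, hE, hQ.deconcat_apply, TensorProduct.map_map, TensorProduct.map_map]

theorem isCoalgHom_comp (hE : IsCoderivation G F E)
    {Q : TensorAlgebra k W →ₗ[k] TensorAlgebra k U} (hQ : IsCoalgHom Q) :
    IsCoderivation (Q ∘ₗ G) (Q ∘ₗ F) (Q ∘ₗ E) := fun x => by
  rw [LinearMap.comp_apply, hQ.deconcat_apply, hE, map_add, TensorProduct.map_map,
    TensorProduct.map_map]

theorem of_comp {Q : TensorAlgebra k U →ₗ[k] TensorAlgebra k V} (hQ : IsCoalgHom Q)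
    (surj : Function.Surjective Q) (hE : IsCoderivation (G ∘ₗ Q) (F ∘ₗ Q) (E ∘ₗ Q)) :
    IsCoderivation G F E := fun y => by
  obtain ⟨x, rfl⟩ := surj y
  rw [hQ.deconcat_apply, TensorProduct.map_map, TensorProduct.map_map, ← hE x,
    LinearMap.comp_apply]

section Counital

variable (hE : IsCoderivation G F E) (hG : ∀ x, algebraMapInv (G x) = algebraMapInv x)
  (hF : ∀ x, algebraMapInv (F x) = algebraMapInv x)

include hE hG hF

theorem counit_apply (x : TensorAlgebra k V) : algebraMapInv (E x) = 0 := by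
  have counit_E : (algebraMapInv.toLinearMap ∘ₗ E) x ⊗ₜ[k] (1 : k) +
      1 ⊗ₜ[k] (algebraMapInv.toLinearMap ∘ₗ E) x = 1 ⊗ₜ[k] algebraMapInv (E x) := by
    have hGε : algebraMapInv.toLinearMap ∘ₗ G = algebraMapInv.toLinearMap := LinearMap.ext hG
    have hFε : algebraMapInv.toLinearMap ∘ₗ F = algebraMapInv.toLinearMap := LinearMap.ext hF
    have h := congrArg (algebraMapInv.toLinearMap.lTensor k ∘ₗ
      algebraMapInv.toLinearMap.rTensor (TensorAlgebra k W)) (hE x)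
    rwa [LinearMap.comp_apply, rTensor_counit_deconcat, LinearMap.lTensor_comp_rTensor, map_add,
      TensorProduct.map_map, TensorProduct.map_map, hGε, hFε, ← LinearMap.rTensor_comp_lTensor,
      ← LinearMap.lTensor_comp_rTensor, LinearMap.comp_apply, LinearMap.comp_apply,
      rTensor_counit_deconcat, lTensor_counit_deconcat, LinearMap.lTensor_tmul,
      LinearMap.lTensor_tmul, LinearMap.rTensor_tmul, eq_comm] at h
  simpa using congrArg (TensorProduct.rid k k) counit_E

theorem first_letter (x : TensorAlgebra k V) :
    E x = LinearMap.mul' k _ (TensorProduct.map (ι k ∘ₗ ιInv ∘ₗ E) F (deconcat k V x)) +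
      LinearMap.mul' k _ (TensorProduct.map (ι k ∘ₗ ιInv ∘ₗ G) E (deconcat k V x)) := by
  conv_lhs => rw [eq_counit_add_first_letter (E x), hE.counit_apply hG hF, hE]
  simp [LinearMap.rTensor_map, LinearMap.comp_assoc]

theorem map_one (hG1 : G 1 = 1) (h : ιInv (E 1) = 0) : E 1 = 0 := by
  rw [hE.first_letter hG hF, deconcat_one]
  simp [h, hG1]

theorem eq_zero (hG1 : G 1 = 1) (h : ιInv ∘ₗ E = 0) : E = 0 := by
  have hE1 : E 1 = 0 := hE.map_one hG hF hG1 (LinearMap.congr_fun h 1)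
  refine linearMap_ext_deconcat hE1 fun a x hx => ?_
  rw [LinearMap.lTensor_zero, LinearMap.zero_apply] at hx
  rw [hE.first_letter hG hF, h, LinearMap.comp_zero, TensorProduct.map_zero_left,
    map_deconcat_ι_mul, ← LinearMap.rTensor_comp_lTensor,
    LinearMap.comp_apply (LinearMap.rTensor _ _), hx]
  simp [hG1]

end Counital

end IsCoderivation

theorem IsCoalgHom.ext {F G : TensorAlgebra k V →ₗ[k] TensorAlgebra k W} (hF : IsCoalgHom F)
    (hG : IsCoalgHom G) (hG1 : G 1 = 1) (h : ιInv ∘ₗ F = ιInv ∘ₗ G) : F = G :=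
  sub_eq_zero.mp <| (hF.isCoderivation_sub hG).eq_zero hG.counit_apply hF.counit_apply hG1 <| by
    rw [LinearMap.comp_sub, h, sub_self]

end CoalgHom

section SkewDerivation

variable {k : Type v} [CommRing k] {V : Type u} [AddCommGroup V] [Module k V]
  {W : Type u'} [AddCommGroup W] [Module k W] {U : Type*} [AddCommGroup U] [Module k U]

/-- The upper triangular matrices of letters whose products compute `skewDerivation`. -/
def skewMatrix (α g β : V →ₗ[k] W) : V →ₗ[k] Matrix (Fin 2) (Fin 2) (TensorAlgebra k W) where
  toFun v := !![ι k (α v), ι k (g v); 0, ι k (β v)]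
  map_add' v w := by simp
  map_smul' c v := by simp

theorem skewMatrix_apply (α g β : V →ₗ[k] W) (v : V) :
    skewMatrix α g β v = !![ι k (α v), ι k (g v); 0, ι k (β v)] := rfl

/-- The map `v₁ ⋯ vₙ ↦ ∑ᵢ α v₁ ⋯ α vᵢ₋₁ · g vᵢ · β vᵢ₊₁ ⋯ β vₙ`, obtained as the upper right entry
of an algebra map into upper triangular matrices. -/
def skewDerivation (α g β : V →ₗ[k] W) : TensorAlgebra k V →ₗ[k] TensorAlgebra k W :=
  Matrix.entryLinearMap k _ 0 1 ∘ₗ (TensorAlgebra.lift k (skewMatrix α g β)).toLinearMap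

@[simp] theorem skewDerivation_one (α g β : V →ₗ[k] W) : skewDerivation α g β 1 = 0 := by
  simp [skewDerivation]

@[simp] theorem skewDerivation_ι_mul (α g β : V →ₗ[k] W) (a : V) (x : TensorAlgebra k V) :
    skewDerivation α g β (ι k a * x) =
      ι k (g a) * tmap β x + ι k (α a) * skewDerivation α g β x := by
  have lift_one_one : Matrix.entryLinearMap k _ 1 1 ∘ₗ
      (TensorAlgebra.lift k (skewMatrix α g β)).toLinearMap = (tmap β).toLinearMap :=
    linearMap_ext_ι_mul (by simp) fun a x hx => by
      simp only [LinearMap.comp_apply, AlgHom.toLinearMap_apply,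
        Matrix.entryLinearMap_apply] at hx ⊢
      simp [Matrix.mul_apply, hx, skewMatrix_apply]
  rw [← AlgHom.toLinearMap_apply, ← lift_one_one, add_comm]
  simp [skewDerivation, skewMatrix_apply, Matrix.vecMul, dotProduct]

@[simp] theorem skewDerivation_ι (α g β : V →ₗ[k] W) (a : V) :
    skewDerivation α g β (ι k a) = ι k (g a) := by
  simpa using skewDerivation_ι_mul α g β a 1

@[simp] theorem algebraMapInv_skewDerivation (α g β : V →ₗ[k] W) (x : TensorAlgebra k V) :
    algebraMapInv (skewDerivation α g β x) = 0 := by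
  suffices h : algebraMapInv.toLinearMap ∘ₗ skewDerivation α g β = 0 from LinearMap.congr_fun h x
  exact linearMap_ext_ι_mul (by simp) fun a x _ => by simp

@[simp] theorem ιInv_skewDerivation (α g β : V →ₗ[k] W) (x : TensorAlgebra k V) :
    ιInv (skewDerivation α g β x) = g (ιInv x) := by
  suffices h : ιInv ∘ₗ skewDerivation α g β = g ∘ₗ ιInv from LinearMap.congr_fun h x
  exact linearMap_ext_ι_mul (by simp) fun a x _ => by simp

theorem skewDerivation_tmap_eq_zero {α g β : V →ₗ[k] W} {f : U →ₗ[k] V}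
    (h : ∀ x, g (f x) = 0) (x : TensorAlgebra k U) : skewDerivation α g β (tmap f x) = 0 := by
  induction x using ι_mul_induction <;> simp_all

theorem tmap_skewDerivation_eq_zero {α g β : V →ₗ[k] W} {f : W →ₗ[k] U}
    (h : ∀ x, f (g x) = 0) (x : TensorAlgebra k V) : tmap f (skewDerivation α g β x) = 0 := by
  induction x using ι_mul_induction <;> simp_all

theorem skewDerivation_skewDerivation_eq_zero {σ d : V →ₗ[k] V}
    (hdd : ∀ x, d (d x) = 0) (hσd : ∀ x, σ (d x) = -d (σ x)) (x : TensorAlgebra k V) :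
    skewDerivation σ d LinearMap.id (skewDerivation σ d LinearMap.id x) = 0 := by
  induction x using ι_mul_induction <;> simp_all

end SkewDerivation

section CoalgLift

variable {k : Type v} [Field k] {V : Type u} [AddCommGroup V] [Module k V]
  {W : Type u'} [AddCommGroup W] [Module k W]

theorem isCoderivation_skewDerivation (α g β : V →ₗ[k] W) :
    IsCoderivation (tmap α).toLinearMap (tmap β).toLinearMap (skewDerivation α g β) := by
  refine LinearMap.congr_fun (f := deconcat k W ∘ₗ skewDerivation α g β) (g :=
    TensorProduct.map _ _ ∘ₗ deconcat k V + TensorProduct.map _ _ ∘ₗ deconcat k V) ?_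
  refine linearMap_ext_ι_mul (by simp [deconcat_one]) fun a x hx => ?_
  have tmap_mulLeft : (tmap α).toLinearMap ∘ₗ LinearMap.mulLeft k (ι k a) =
      LinearMap.mulLeft k (ι k (α a)) ∘ₗ (tmap α).toLinearMap := by ext; simp
  have skew_mulLeft : skewDerivation α g β ∘ₗ LinearMap.mulLeft k (ι k a) =
      LinearMap.mulLeft k (ι k (g a)) ∘ₗ (tmap β).toLinearMap +
        LinearMap.mulLeft k (ι k (α a)) ∘ₗ skewDerivation α g β := by ext; simp
  have hβ := (isCoalgHom_tmap β).deconcat_apply x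
  simp only [LinearMap.comp_apply, LinearMap.add_apply, AlgHom.toLinearMap_apply] at hx hβ ⊢
  rw [map_deconcat_ι_mul, map_deconcat_ι_mul, tmap_mulLeft, skew_mulLeft,
    TensorProduct.map_add_left, LinearMap.add_apply, ← LinearMap.rTensor_map,
    ← LinearMap.rTensor_map, ← LinearMap.rTensor_map, ← hβ, skewDerivation_ι_mul, map_add,
    deconcat_ι_mul, deconcat_ι_mul, hx, ι_tmul_one_mul, ι_tmul_one_mul]
  simp [TensorProduct.tmul_add]
  abel

/-- `prepend f a (u ⊗ w) = f(a u) · w`: apply `f` to the word `a u` and put the resulting letter in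
front of `w`. -/
def prepend (f : TensorAlgebra k V →ₗ[k] W) :
    V →ₗ[k] TensorAlgebra k V ⊗[k] TensorAlgebra k W →ₗ[k] TensorAlgebra k W :=
  LinearMap.compRight k (LinearMap.mul' k (TensorAlgebra k W)) ∘ₗ
    LinearMap.rTensorHom (TensorAlgebra k W) ∘ₗ
      LinearMap.compRight k (ι k ∘ₗ f) ∘ₗ LinearMap.mul k (TensorAlgebra k V) ∘ₗ ι k

@[simp] theorem prepend_tmul (f : TensorAlgebra k V →ₗ[k] W) (a : V) (u : TensorAlgebra k V)
    (w : TensorAlgebra k W) : prepend f a (u ⊗ₜ[k] w) = ι k (f (ι k a * u)) * w := rfl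

/-- The map `x ↦ lTensor (coalgLift f) (Δ x)`, which satisfies a recursion on words; see
`lTensor_coalgLift_deconcat`. -/
def coalgLiftState (f : TensorAlgebra k V →ₗ[k] W) :
    TensorAlgebra k V →ₗ[k] TensorAlgebra k V ⊗[k] TensorAlgebra k W :=
  LinearMap.applyₗ (1 ⊗ₜ[k] 1) ∘ₗ (TensorAlgebra.lift k
    (LinearMap.compRight k (TensorProduct.mk k _ _ 1) ∘ₗ prepend f +
      LinearMap.rTensorHom (TensorAlgebra k W) ∘ₗ
        LinearMap.mul k (TensorAlgebra k V) ∘ₗ ι k)).toLinearMap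

@[simp] theorem coalgLiftState_one (f : TensorAlgebra k V →ₗ[k] W) :
    coalgLiftState f 1 = 1 ⊗ₜ[k] 1 := by
  simp [coalgLiftState]

theorem coalgLiftState_ι_mul (f : TensorAlgebra k V →ₗ[k] W) (a : V) (x : TensorAlgebra k V) :
    coalgLiftState f (ι k a * x) = 1 ⊗ₜ[k] prepend f a (coalgLiftState f x) +
      (LinearMap.mulLeft k (ι k a)).rTensor _ (coalgLiftState f x) := by
  simp only [coalgLiftState, LinearMap.comp_apply, AlgHom.toLinearMap_apply, map_mul]
  simp
  rfl

/-- The coalgebra homomorphism with corestriction `f`: it sends a word to the sum over all its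
factorizations `x₁ ⋯ xᵣ` into nonempty words of `f x₁ ⋯ f xᵣ`. -/
def coalgLift (f : TensorAlgebra k V →ₗ[k] W) : TensorAlgebra k V →ₗ[k] TensorAlgebra k W :=
  (TensorProduct.lid k _).toLinearMap ∘ₗ algebraMapInv.toLinearMap.rTensor _ ∘ₗ coalgLiftState f

@[simp] theorem coalgLift_one (f : TensorAlgebra k V →ₗ[k] W) : coalgLift f 1 = 1 := by
  simp [coalgLift]

theorem coalgLift_ι_mul_eq_state (f : TensorAlgebra k V →ₗ[k] W) (a : V)
    (x : TensorAlgebra k V) : coalgLift f (ι k a * x) = prepend f a (coalgLiftState f x) := by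
  have counit_mulLeft : (algebraMapInv (R := k) (M := V)).toLinearMap ∘ₗ
      LinearMap.mulLeft k (ι k a) = 0 := by ext; simp
  simp only [coalgLift, LinearMap.comp_apply, coalgLiftState_ι_mul, map_add,
    ← LinearMap.rTensor_comp_apply, counit_mulLeft]
  simp

theorem lTensor_coalgLift_deconcat (f : TensorAlgebra k V →ₗ[k] W) (x : TensorAlgebra k V) :
    (coalgLift f).lTensor _ (deconcat k V x) = coalgLiftState f x := by
  suffices h : (coalgLift f).lTensor _ ∘ₗ deconcat k V = coalgLiftState f from
    LinearMap.congr_fun h x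
  refine linearMap_ext_ι_mul (by simp [deconcat_one]) fun a x hx => ?_
  rw [LinearMap.comp_apply] at hx ⊢
  rw [LinearMap.lTensor, map_deconcat_ι_mul, LinearMap.id_comp, ← LinearMap.rTensor_comp_lTensor,
    LinearMap.comp_apply, hx, coalgLiftState_ι_mul, coalgLift_ι_mul_eq_state, LinearMap.id_apply]

theorem coalgLift_ι_mul (f : TensorAlgebra k V →ₗ[k] W) (a : V) (x : TensorAlgebra k V) :
    coalgLift f (ι k a * x) = prepend f a ((coalgLift f).lTensor _ (deconcat k V x)) := by
  rw [coalgLift_ι_mul_eq_state, lTensor_coalgLift_deconcat]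

theorem deconcat_prepend (f : TensorAlgebra k V →ₗ[k] W) (a : V)
    (z : TensorAlgebra k V ⊗[k] TensorAlgebra k W) :
    deconcat k W (prepend f a z) = 1 ⊗ₜ[k] prepend f a z + (prepend f a).rTensor _
      ((TensorProduct.assoc k _ _ _).symm ((deconcat k W).lTensor _ z)) := by
  induction z with
  | zero => simp
  | add z z' hz hz' => simp only [map_add, hz, hz', TensorProduct.tmul_add]; abel
  | tmul u w =>
    have mul_deconcat : (prepend f a).rTensor _ ∘ₗ
        (TensorProduct.assoc k _ _ _).symm.toLinearMap ∘ₗ TensorProduct.mk k _ _ u =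
        (LinearMap.mulLeft k (ι k (f (ι k a * u)))).rTensor (TensorAlgebra k W) :=
      TensorProduct.ext' fun _ _ => rfl
    rw [prepend_tmul, deconcat_ι_mul, ι_tmul_one_mul, ← mul_deconcat]
    rfl

theorem isCoalgHom_coalgLift (f : TensorAlgebra k V →ₗ[k] W) : IsCoalgHom (coalgLift f) := by
  constructor
  · refine LinearMap.congr_fun (f := algebraMapInv.toLinearMap ∘ₗ coalgLift f)
      (g := algebraMapInv.toLinearMap) (linearMap_ext_ι_mul (by simp) fun a x _ => ?_)
    have counit_prepend : algebraMapInv.toLinearMap ∘ₗ prepend f a = 0 :=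
      TensorProduct.ext' fun _ _ => by simp
    rw [LinearMap.comp_apply, coalgLift_ι_mul, ← LinearMap.comp_apply, counit_prepend]
    simp
  · refine LinearMap.congr_fun (f := deconcat k W ∘ₗ coalgLift f)
      (g := TensorProduct.map _ _ ∘ₗ deconcat k V)
      (linearMap_ext_deconcat (by simp [deconcat_one]) fun a x hx => ?_)
    have prepend_coalgLift : prepend f a ∘ₗ (coalgLift f).lTensor _ ∘ₗ deconcat k V =
        coalgLift f ∘ₗ LinearMap.mulLeft k (ι k a) := by
      ext y
      simp [coalgLift_ι_mul]
    simp only [LinearMap.lTensor_comp_apply] at hx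
    rw [LinearMap.comp_apply, coalgLift_ι_mul, deconcat_prepend, ← coalgLift_ι_mul, hx,
      LinearMap.comp_apply, map_deconcat_ι_mul, coalgLift_one, ← prepend_coalgLift,
      ← assoc_deconcat, LinearMap.lTensor, TensorProduct.map_map_assoc,
      LinearEquiv.symm_apply_apply, LinearMap.rTensor_map, LinearMap.map_rTensor]
    rfl

theorem ιInv_coalgLift {f : TensorAlgebra k V →ₗ[k] W} (hf : f 1 = 0) (x : TensorAlgebra k V) :
    ιInv (coalgLift f x) = f x := by
  suffices h : ιInv ∘ₗ coalgLift f = f from LinearMap.congr_fun h x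
  refine linearMap_ext_ι_mul (by simp [hf]) fun a x _ => ?_
  have ιInv_prepend : ιInv ∘ₗ prepend f a = f ∘ₗ LinearMap.mulLeft k (ι k a) ∘ₗ
      (TensorProduct.rid k _).toLinearMap ∘ₗ algebraMapInv.toLinearMap.lTensor _ :=
    TensorProduct.ext' fun _ _ => by simp
  have counit_coalgLift : algebraMapInv.toLinearMap ∘ₗ coalgLift f = algebraMapInv.toLinearMap :=
    LinearMap.ext (isCoalgHom_coalgLift f).counit_apply
  rw [LinearMap.comp_apply, coalgLift_ι_mul, ← LinearMap.comp_apply, ιInv_prepend]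
  simp only [LinearMap.comp_apply, ← LinearMap.lTensor_comp_apply, counit_coalgLift,
    lTensor_counit_deconcat]
  simp

end CoalgLift

section LocallyNilpotent

variable {R : Type*} [Ring R] {M : Type*} [AddCommGroup M] [Module R M]

/-- Every vector is killed by a power of `N`. -/
def IsLocallyNilpotent (N : Module.End R M) : Prop := ∀ x, ∃ n, (N ^ n) x = 0

namespace IsLocallyNilpotent

variable {N : Module.End R M}

theorem neg (hN : IsLocallyNilpotent N) : IsLocallyNilpotent (-N) := fun x => by
  obtain ⟨n, hn⟩ := hN x
  exact ⟨n, by rw [neg_pow, Module.End.mul_apply, hn, map_zero]⟩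

theorem mem_of_add_apply_mem (hN : IsLocallyNilpotent N) {p : Submodule R M}
    (hp : ∀ x ∈ p, N x ∈ p) {x : M} (hx : x + N x ∈ p) : x ∈ p := by
  obtain ⟨n, hn⟩ := hN.neg x
  have pow_mem : ∀ i y, y ∈ p → ((-N) ^ i) y ∈ p := fun i y hy => by
    induction i with
    | zero => simpa using hy
    | succ i ih => rw [pow_succ', Module.End.mul_apply]; exact neg_mem (hp _ ih)
  have geom : x = ∑ i ∈ Finset.range n, ((-N) ^ i) (x + N x) := by
    have h := LinearMap.congr_fun (geom_sum_mul_neg (-N) n) x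
    rw [LinearMap.sub_apply, hn, Module.End.mul_apply, LinearMap.sum_apply] at h
    simpa using h.symm
  rw [geom]
  exact sum_mem fun i _ => pow_mem i _ hx

theorem bijective_one_add (hN : IsLocallyNilpotent N) :
    Function.Bijective ⇑(1 + N) := by
  refine ⟨(injective_iff_map_eq_zero _).mpr fun x hx => ?_, fun y => ?_⟩
  · exact (Submodule.mem_bot R).mp
      (hN.mem_of_add_apply_mem (fun y hy => by simp_all) ((Submodule.mem_bot R).mpr hx))
  · obtain ⟨n, hn⟩ := hN.neg y
    have h := LinearMap.congr_fun (mul_neg_geom_sum (-N) n) y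
    rw [LinearMap.sub_apply, hn, Module.End.mul_apply] at h
    exact ⟨(∑ i ∈ Finset.range n, (-N) ^ i) y, by
      simpa [Finset.sum_add_distrib] using h⟩

end IsLocallyNilpotent

end LocallyNilpotent

section WordLength

variable {k : Type v} [CommRing k] {V : Type u} [AddCommGroup V] [Module k V]
  {W : Type u'} [AddCommGroup W] [Module k W] {U : Type*} [AddCommGroup U] [Module k U]

variable (k) in
/-- The word `v₁ ⋯ vₙ` in the tensor algebra. -/
def word (l : List V) : TensorAlgebra k V := (l.map (ι k)).prod

@[simp] theorem word_nil : word k ([] : List V) = 1 := rfl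

@[simp] theorem word_cons (a : V) (l : List V) : word k (a :: l) = ι k a * word k l := by
  simp [word]

theorem tmap_word (g : V →ₗ[k] W) (l : List V) : tmap g (word k l) = word k (l.map g) := by
  induction l with
  | nil => simp
  | cons a l ih => simp [ih]

variable (k V) in
/-- The length filtration of the tensor algebra: the span of the words of length less than `n`. -/
def lengthLT (n : ℕ) : Submodule k (TensorAlgebra k V) :=
  Submodule.span k (word k '' {l | l.length < n})

theorem word_mem_lengthLT {l : List V} {n : ℕ} (h : l.length < n) : word k l ∈ lengthLT k V n :=
  Submodule.subset_span ⟨l, h, rfl⟩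

theorem lengthLT_mono {m n : ℕ} (h : m ≤ n) : lengthLT k V m ≤ lengthLT k V n :=
  Submodule.span_mono (Set.image_mono fun _ hl => lt_of_lt_of_le hl h)

theorem apply_mem_of_mem_lengthLT {M : Submodule k (TensorAlgebra k W)} {n : ℕ}
    {f : TensorAlgebra k V →ₗ[k] TensorAlgebra k W}
    (h : ∀ l : List V, l.length < n → f (word k l) ∈ M) :
    ∀ x ∈ lengthLT k V n, f x ∈ M := by
  suffices lengthLT k V n ≤ M.comap f from this
  rw [lengthLT, Submodule.span_le]
  rintro _ ⟨l, hl, rfl⟩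
  exact h l hl

theorem ι_mul_mem_lengthLT {n : ℕ} (a : V) {x : TensorAlgebra k V} (hx : x ∈ lengthLT k V n) :
    ι k a * x ∈ lengthLT k V (n + 1) :=
  apply_mem_of_mem_lengthLT (f := LinearMap.mulLeft k (ι k a)) (fun l hl => by
    rw [LinearMap.mulLeft_apply, ← word_cons]
    exact word_mem_lengthLT (by simpa using hl)) x hx

theorem exists_mem_lengthLT (x : TensorAlgebra k V) : ∃ n, x ∈ lengthLT k V n := by
  induction x using ι_mul_induction with
  | one => exact ⟨1, word_mem_lengthLT (l := []) (by simp)⟩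
  | add x y hx hy =>
    obtain ⟨m, hm⟩ := hx
    obtain ⟨n, hn⟩ := hy
    exact ⟨max m n, add_mem (lengthLT_mono (le_max_left _ _) hm)
      (lengthLT_mono (le_max_right _ _) hn)⟩
  | smul c x hx =>
    obtain ⟨m, hm⟩ := hx
    exact ⟨m, Submodule.smul_mem _ _ hm⟩
  | ι_mul a x hx =>
    obtain ⟨m, hm⟩ := hx
    exact ⟨m + 1, ι_mul_mem_lengthLT a hm⟩

theorem tmap_mem_lengthLT (g : V →ₗ[k] W) {n : ℕ} :
    ∀ x ∈ lengthLT k V n, tmap g x ∈ lengthLT k W n :=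
  apply_mem_of_mem_lengthLT (f := (tmap g).toLinearMap) fun l hl => by
    rw [AlgHom.toLinearMap_apply, tmap_word]
    exact word_mem_lengthLT (by simpa using hl)

theorem skewDerivation_mem_lengthLT (α g β : V →ₗ[k] W) {n : ℕ} :
    ∀ x ∈ lengthLT k V n, skewDerivation α g β x ∈ lengthLT k W n := by
  refine apply_mem_of_mem_lengthLT fun l hl => ?_
  induction l generalizing n with
  | nil => simp
  | cons a l ih =>
    obtain ⟨n, rfl⟩ : ∃ m, n = m + 1 := ⟨n - 1, by grind⟩
    have hl' : l.length < n := by simpa using hl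
    rw [word_cons, skewDerivation_ι_mul]
    exact add_mem (ι_mul_mem_lengthLT _ (tmap_mem_lengthLT _ _ (word_mem_lengthLT hl')))
      (ι_mul_mem_lengthLT _ (ih hl'))

/-- `N` sends every word to a combination of strictly shorter words. -/
def LowersLength (N : TensorAlgebra k V →ₗ[k] TensorAlgebra k W) : Prop :=
  ∀ n, ∀ x ∈ lengthLT k V (n + 1), N x ∈ lengthLT k W n

namespace LowersLength

theorem of_word {N : TensorAlgebra k V →ₗ[k] TensorAlgebra k W}
    (h : ∀ l : List V, N (word k l) ∈ lengthLT k W l.length) : LowersLength N := fun _ =>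
  apply_mem_of_mem_lengthLT fun l hl => lengthLT_mono (Nat.le_of_lt_succ hl) (h l)

theorem comp_left {N : TensorAlgebra k V →ₗ[k] TensorAlgebra k W} (hN : LowersLength N)
    {F : TensorAlgebra k W →ₗ[k] TensorAlgebra k U}
    (hF : ∀ n, ∀ x ∈ lengthLT k W n, F x ∈ lengthLT k U n) : LowersLength (F ∘ₗ N) :=
  fun n x hx => hF n _ (hN n x hx)

theorem comp_right {N : TensorAlgebra k W →ₗ[k] TensorAlgebra k U} (hN : LowersLength N)
    {F : TensorAlgebra k V →ₗ[k] TensorAlgebra k W}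
    (hF : ∀ n, ∀ x ∈ lengthLT k V n, F x ∈ lengthLT k W n) : LowersLength (N ∘ₗ F) :=
  fun n x hx => hN n _ (hF _ x hx)

theorem isLocallyNilpotent {N : Module.End k (TensorAlgebra k V)} (hN : LowersLength N) :
    IsLocallyNilpotent N := fun x => by
  obtain ⟨n, hn⟩ := exists_mem_lengthLT x
  refine ⟨n, ?_⟩
  induction n generalizing x with
  | zero => simpa [lengthLT] using hn
  | succ n ih => exact ih (N x) (hN n x hn)

end LowersLength

end WordLength

section CoalgLift

variable {k : Type v} [Field k] {V : Type u} [AddCommGroup V] [Module k V]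
  {W : Type u'} [AddCommGroup W] [Module k W]

theorem deconcat_word (l : List V) :
    deconcat k V (word k l) =
      ∑ i ∈ Finset.range (l.length + 1), word k (l.take i) ⊗ₜ[k] word k (l.drop i) :=
  deconcat_prod k V l

theorem IsCoderivation.lowersLength {α : V →ₗ[k] V}
    {E : TensorAlgebra k V →ₗ[k] TensorAlgebra k V}
    (hE : IsCoderivation (tmap α).toLinearMap LinearMap.id E)
    (hE1 : E 1 = 0) (hEι : ∀ a, ιInv (E (ι k a)) = 0) : LowersLength E := by
  refine LowersLength.of_word fun l => ?_
  induction l with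
  | nil => simp [hE1]
  | cons a l ih =>
    have tail : (ι k ∘ₗ ιInv ∘ₗ (tmap α).toLinearMap) ∘ₗ LinearMap.mulLeft k (ι k a) =
        LinearMap.toSpanSingleton k _ (ι k (α a)) ∘ₗ algebraMapInv.toLinearMap := by ext; simp
    rw [word_cons, hE.first_letter (algebraMapInv_tmap α) fun _ => rfl, map_deconcat_ι_mul,
      map_deconcat_ι_mul, tail, ← LinearMap.map_rTensor (f := LinearMap.toSpanSingleton k _ _),
      rTensor_counit_deconcat, deconcat_word]
    simp only [LinearMap.comp_apply, hE1, map_zero, TensorProduct.zero_tmul, zero_add,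
      AlgHom.toLinearMap_apply, ιInv_tmap, ιInv_one, TensorProduct.map_tmul, map_sum,
      LinearMap.mul'_apply, LinearMap.mulLeft_apply, LinearMap.id_apply,
      LinearMap.toSpanSingleton_apply, one_smul]
    refine add_mem (sum_mem fun i _ => ?_) (ι_mul_mem_lengthLT _ ih)
    cases i with
    | zero => simp [hEι]
    | succ i =>
      cases l with
      | nil => simp [hEι]
      | cons b l => exact ι_mul_mem_lengthLT _ (word_mem_lengthLT (by grind))

theorem coalgLift_word_cons (f : TensorAlgebra k V →ₗ[k] W) (a : V) (l : List V) :
    coalgLift f (word k (a :: l)) = ∑ i ∈ Finset.range (l.length + 1),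
      ι k (f (word k (a :: l.take i))) * coalgLift f (word k (l.drop i)) := by
  rw [word_cons, coalgLift_ι_mul, deconcat_word]
  simp

theorem coalgLift_mem_lengthLT (f : TensorAlgebra k V →ₗ[k] W) {n : ℕ} :
    ∀ x ∈ lengthLT k V n, coalgLift f x ∈ lengthLT k W n := by
  refine apply_mem_of_mem_lengthLT fun l hl => ?_
  induction n generalizing l with
  | zero => simp at hl
  | succ n ih =>
    cases l with
    | nil => simpa using word_mem_lengthLT (k := k) (V := W) (l := []) n.succ_pos
    | cons a l =>
      rw [coalgLift_word_cons]
      exact sum_mem fun i _ => ι_mul_mem_lengthLT _ (ih _ (by grind))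

theorem lowersLength_coalgLift_sub_tmap (f : TensorAlgebra k V →ₗ[k] W) :
    LowersLength (coalgLift f - (tmap (f ∘ₗ ι k)).toLinearMap) := by
  refine LowersLength.of_word fun l => ?_
  induction l with
  | nil => simp
  | cons a l ih =>
    have := ι_mul_mem_lengthLT (f (ι k a)) ih
    rw [LinearMap.sub_apply, coalgLift_word_cons, Finset.sum_range_succ', add_sub_assoc]
    refine add_mem (sum_mem fun i hi => ?_) ?_
    · have hi : i < l.length := by simpa using hi
      rw [List.length_cons]
      exact ι_mul_mem_lengthLT _ (coalgLift_mem_lengthLT f _ (word_mem_lengthLT (by grind)))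
    · simpa [mul_sub] using this

variable {f : TensorAlgebra k V →ₗ[k] W} {e : V ≃ₗ[k] W}

theorem isLocallyNilpotent_tmap_symm_comp_coalgLift_sub_one (he : f ∘ₗ ι k = e.toLinearMap) :
    IsLocallyNilpotent ((tmap e.symm.toLinearMap).toLinearMap ∘ₗ coalgLift f - 1) := by
  have tmap_comp_tmap :
      (tmap e.symm.toLinearMap).toLinearMap ∘ₗ (tmap (f ∘ₗ ι k)).toLinearMap = 1 :=
    LinearMap.ext fun x => by
      rw [LinearMap.comp_apply, AlgHom.toLinearMap_apply, AlgHom.toLinearMap_apply, tmap_tmap, he,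
        LinearEquiv.symm_comp, tmap_id]
      rfl
  rw [← tmap_comp_tmap, ← LinearMap.comp_sub]
  exact ((lowersLength_coalgLift_sub_tmap f).comp_left fun _ =>
    tmap_mem_lengthLT _).isLocallyNilpotent

theorem surjective_coalgLift (he : f ∘ₗ ι k = e.toLinearMap) :
    Function.Surjective (coalgLift f) := by
  have tmap_symm_injective : Function.Injective (tmap (k := k) e.symm.toLinearMap) :=
    Function.LeftInverse.injective (g := tmap e.toLinearMap) fun x => by
      rw [tmap_tmap, LinearEquiv.comp_symm, tmap_id, AlgHom.id_apply]
  intro y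
  obtain ⟨x, hx⟩ := (isLocallyNilpotent_tmap_symm_comp_coalgLift_sub_one he).bijective_one_add.2
    (tmap e.symm.toLinearMap y)
  exact ⟨x, tmap_symm_injective (by simpa using hx)⟩

end CoalgLift

section Contraction

/-- `p` and `i` exhibit `N`, with zero differential, as a strong deformation retract of the complex
`(M, d)` with homotopy `h`, subject to the usual side conditions. -/
structure IsContraction {R M N : Type*} [Ring R] [AddCommGroup M] [Module R M] [AddCommGroup N]
    [Module R N] (d h : Module.End R M) (p : M →ₗ[R] N) (i : N →ₗ[R] M) : Prop where
  d_d : ∀ x, d (d x) = 0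
  homotopy : ∀ x, d (h x) + h (d x) = x - i (p x)
  h_h : ∀ x, h (h x) = 0
  h_i : ∀ x, h (i x) = 0
  p_h : ∀ x, p (h x) = 0
  p_d : ∀ x, p (d x) = 0
  d_i : ∀ x, d (i x) = 0
  p_i : ∀ x, p (i x) = x

namespace IsContraction

section Perturbation

variable {R : Type*} [Ring R] {M : Type*} [AddCommGroup M] [Module R M] {N : Type*}
  [AddCommGroup N] [Module R N] {d h m : Module.End R M} {p q : M →ₗ[R] N} {i : N →ₗ[R] M}

theorem perturbed_h (C : IsContraction d h p i) (hq : ∀ x, q (x + (m - d) (h x)) = p x) (x : M) :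
    q (h x) = 0 := by
  simpa [C.h_h, C.p_h] using hq (h x)

theorem perturbed_i (C : IsContraction d h p i) (hq : ∀ x, q (x + (m - d) (h x)) = p x) (x : N) :
    q (i x) = x := by
  simpa [C.h_i, C.p_i] using hq (i x)

/-- The basic perturbation lemma: `q` is a chain map for the perturbed differential `m` on `M` and
the transferred one, `q m i`, on `N`. -/
theorem perturbed_comm (C : IsContraction d h p i) (hq : ∀ x, q (x + (m - d) (h x)) = p x)
    (hm : ∀ x, m (m x) = 0) (surj : ∀ x, ∃ y, y + (m - d) (h y) = x) (x : M) :
    q (m (i (q x))) = q (m x) := by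
  obtain ⟨y, rfl⟩ := surj x
  have h_d : h (d y) = y - i (p y) - d (h y) := eq_sub_of_add_eq' (C.homotopy y)
  have m_perturbed : m (y + (m - d) (h y)) - m (i (p y)) = d y + (m - d) (h (d y)) := by
    simp only [h_d, LinearMap.sub_apply, map_add, map_sub, hm, C.d_d, C.d_i]
    abel
  rw [hq, ← sub_eq_zero, ← map_sub, ← neg_sub, map_neg, m_perturbed, hq, C.p_d, neg_zero]

end Perturbation

section TensorTrick

variable {k : Type v} [CommRing k] {V : Type u} [AddCommGroup V] [Module k V]
  {W : Type u'} [AddCommGroup W] [Module k W]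
  {σ d h : V →ₗ[k] V} {p : V →ₗ[k] W} {i : W →ₗ[k] V}

theorem tensorAlgebra (C : IsContraction d h p i) (hσσ : ∀ x, σ (σ x) = x)
    (hσd : ∀ x, σ (d x) = -d (σ x)) :
    IsContraction (skewDerivation σ d LinearMap.id) (skewDerivation σ h (i ∘ₗ p))
      (tmap p).toLinearMap (tmap i).toLinearMap where
  d_d := skewDerivation_skewDerivation_eq_zero C.d_d hσd
  homotopy x := by
    induction x using ι_mul_induction with
    | one => simp
    | add x y hx hy => simp only [map_add]; rw [add_add_add_comm, hx, hy, add_sub_add_comm]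
    | smul c x hx => simp only [map_smul]; rw [← smul_add, hx, smul_sub]
    | ι_mul a x hx =>
      simp only [AlgHom.toLinearMap_apply] at hx ⊢
      simp only [skewDerivation_ι_mul, map_add, tmap_comp, AlgHom.comp_apply, tmap_id,
        AlgHom.id_apply, skewDerivation_tmap_eq_zero C.d_i, tmap_skewDerivation_eq_zero C.p_d,
        hσσ, hσd, map_mul, tmap_ι, eq_sub_of_add_eq hx, eq_sub_of_add_eq (C.homotopy a), map_neg,
        map_sub, map_zero]
      noncomm_ring
  h_h x := by
    induction x using ι_mul_induction with
    | one => simp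
    | add x y hx hy => simp [hx, hy]
    | smul c x hx => simp [hx]
    | ι_mul a x hx =>
      simp [tmap_comp, hx, C.h_h, skewDerivation_tmap_eq_zero C.h_i,
        tmap_skewDerivation_eq_zero C.p_h]
  h_i := skewDerivation_tmap_eq_zero C.h_i
  p_h := tmap_skewDerivation_eq_zero C.p_h
  p_d := tmap_skewDerivation_eq_zero C.p_d
  d_i := skewDerivation_tmap_eq_zero C.d_i
  p_i x := by
    rw [AlgHom.toLinearMap_apply, AlgHom.toLinearMap_apply, tmap_tmap,
      show p ∘ₗ i = LinearMap.id from LinearMap.ext C.p_i, tmap_id, AlgHom.id_apply]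

end TensorTrick

section CoalgHom

variable {k : Type v} [Field k] {V : Type u} [AddCommGroup V] [Module k V]
  {W : Type u'} [AddCommGroup W] [Module k W]
  {d h m σ : Module.End k (TensorAlgebra k V)} {σ' : Module.End k (TensorAlgebra k W)}
  {p q : TensorAlgebra k V →ₗ[k] TensorAlgebra k W} {i : TensorAlgebra k W →ₗ[k] TensorAlgebra k V}

theorem isCoalgHom_perturbed (C : IsContraction d h p i)
    (hq : ∀ x, q (x + (m - d) (h x)) = p x) (surj : ∀ x, ∃ y, y + (m - d) (h y) = x)
    (hμ : IsCoderivation σ LinearMap.id (m - d)) (hh : IsCoderivation σ (i ∘ₗ p) h)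
    (hp : IsCoalgHom p) (hσ : ∀ x, algebraMapInv (σ x) = algebraMapInv x)
    (hσσ : ∀ x, σ (σ x) = x) (hqσ : ∀ x, q (σ x) = σ' (q x)) : IsCoalgHom q := by
  constructor <;> intro x <;> obtain ⟨y, rfl⟩ := surj x
  · rw [hq, hp.counit_apply, map_add, hμ.counit_apply hσ fun _ => rfl, add_zero]
  · have q_h : q ∘ₗ h = 0 := LinearMap.ext (C.perturbed_h hq)
    have q_i_p : q ∘ₗ i ∘ₗ p = p := LinearMap.ext fun x => C.perturbed_i hq (p x)
    have q_μ_h : q ∘ₗ (m - d) ∘ₗ h = p - q := LinearMap.ext fun x => by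
      rw [LinearMap.sub_apply, ← hq x, map_add, add_sub_cancel_left]; rfl
    have q_σ_σ : q ∘ₗ σ ∘ₗ σ = q := LinearMap.ext fun x => congrArg q (hσσ x)
    have q_σ_h : q ∘ₗ σ ∘ₗ h = 0 := LinearMap.ext fun x => by
      simp [hqσ, C.perturbed_h hq]
    simp only [hq, map_add, hp.deconcat_apply, hμ (h y), hh y, TensorProduct.map_map,
      LinearMap.id_comp, ← LinearMap.comp_assoc]
    simp only [LinearMap.comp_assoc, q_h, q_i_p, q_μ_h, q_σ_σ, q_σ_h, map_sub_left, map_sub_right,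
      TensorProduct.map_zero_left, TensorProduct.map_zero_right, LinearMap.sub_apply,
      LinearMap.zero_apply]
    abel

end CoalgHom

end IsContraction

end Contraction

section GradedMaps

variable {R : Type*} [Ring R] {M N P : Type*} [AddCommGroup M] [Module R M] [AddCommGroup N]
  [Module R N] [AddCommGroup P] [Module R P]
  {𝒜 : ℤ → Submodule R M} {ℬ : ℤ → Submodule R N} {𝒞 : ℤ → Submodule R P}

/-- `f` raises degrees by `r`, for given homogeneous parts of its source and target. -/
def HasDegree (𝒜 : ℤ → Submodule R M) (ℬ : ℤ → Submodule R N) (f : M →ₗ[R] N) (r : ℤ) : Prop :=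
  ∀ d, ∀ x ∈ 𝒜 d, f x ∈ ℬ (d + r)

/-- `S` multiplies the part of degree `d` by `(-1)^d`. -/
def IsSign (𝒜 : ℤ → Submodule R M) (S : Module.End R M) : Prop :=
  ∀ d, ∀ x ∈ 𝒜 d, S x = d.negOnePow • x

namespace HasDegree

theorem id : HasDegree 𝒜 𝒜 LinearMap.id 0 := fun d x hx => by rwa [add_zero]

theorem comp {g : N →ₗ[R] P} {f : M →ₗ[R] N} {r s t : ℤ} (hg : HasDegree ℬ 𝒞 g s)
    (hf : HasDegree 𝒜 ℬ f r) (h : r + s = t) : HasDegree 𝒜 𝒞 (g ∘ₗ f) t := fun d x hx => by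
  rw [← h, ← add_assoc]
  exact hg _ _ (hf d x hx)

theorem add {f g : M →ₗ[R] N} {r : ℤ} (hf : HasDegree 𝒜 ℬ f r) (hg : HasDegree 𝒜 ℬ g r) :
    HasDegree 𝒜 ℬ (f + g) r := fun d x hx => add_mem (hf d x hx) (hg d x hx)

theorem sub {f g : M →ₗ[R] N} {r : ℤ} (hf : HasDegree 𝒜 ℬ f r) (hg : HasDegree 𝒜 ℬ g r) :
    HasDegree 𝒜 ℬ (f - g) r := fun d x hx => sub_mem (hf d x hx) (hg d x hx)

theorem mem {f : M →ₗ[R] N} (hf : HasDegree 𝒜 ℬ f 0) {d : ℤ} {x : M} (hx : x ∈ 𝒜 d) :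
    f x ∈ ℬ d := by
  simpa using hf d x hx

theorem sign_apply {f : M →ₗ[R] N} {r : ℤ} (hf : HasDegree 𝒜 ℬ f r) (h𝒜 : ⨆ d, 𝒜 d = ⊤)
    {S : Module.End R M} {S' : Module.End R N} (hS : IsSign 𝒜 S) (hS' : IsSign ℬ S') (x : M) :
    S' (f x) = r.negOnePow • f (S x) := by
  refine Submodule.iSup_induction 𝒜 (motive := fun x => S' (f x) = r.negOnePow • f (S x))
    (h𝒜 ▸ Submodule.mem_top : x ∈ ⨆ d, 𝒜 d) (fun d x hx => ?_) (by simp) fun x y hx hy => ?_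
  · rw [hS' _ _ (hf d x hx), hS d x hx, Units.smul_def d.negOnePow, map_zsmul, ← Units.smul_def,
      smul_smul, Int.negOnePow_add, mul_comm]
  · simp only [map_add, smul_add, hx, hy]

end HasDegree

theorem IsSign.apply_apply {S : Module.End R M} (hS : IsSign 𝒜 S) (h𝒜 : ⨆ d, 𝒜 d = ⊤) (x : M) :
    S (S x) = x := by
  refine Submodule.iSup_induction 𝒜 (motive := fun x => S (S x) = x)
    (h𝒜 ▸ Submodule.mem_top : x ∈ ⨆ d, 𝒜 d) (fun d x hx => ?_) (by simp) fun x y hx hy => ?_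
  · rw [hS d x hx, Units.smul_def, map_zsmul, hS d x hx, ← Units.smul_def, smul_smul]
    simp
  · rw [map_add, map_add, hx, hy]

theorem IsLocallyNilpotent.exists_hasDegree_leftInverse {N : Module.End R M}
    (hN : IsLocallyNilpotent N) (hdeg : HasDegree 𝒜 𝒜 N 0) :
    ∃ G : Module.End R M, HasDegree 𝒜 𝒜 G 0 ∧ ∀ x, G (x + N x) = x := by
  let E := LinearEquiv.ofBijective (1 + N) hN.bijective_one_add
  have symm_apply (x : M) : E.symm (x + N x) = x := E.symm_apply_apply x
  refine ⟨E.symm.toLinearMap, fun d x hx => ?_, symm_apply⟩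
  obtain ⟨y, rfl⟩ := hN.bijective_one_add.2 x
  rw [add_zero, LinearEquiv.coe_coe, show (1 + N) y = y + N y from rfl, symm_apply]
  exact hN.mem_of_add_apply_mem (fun y hy => hdeg.mem hy) hx

end GradedMaps

section DirectSum

variable (k : Type v) [CommRing k] (H : ℤ → Type u) [∀ d, AddCommGroup (H d)]
  [∀ d, Module k (H d)] {H' : ℤ → Type u'} [∀ d, AddCommGroup (H' d)] [∀ d, Module k (H' d)]

/-- The summand of degree `e` of `⨁ d, H d`. -/
def piece (e : ℤ) : Submodule k (⨁ d, H d) := LinearMap.range (DirectSum.lof k ℤ H e)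

/-- The sign involution `x ↦ (-1)^{|x|} x`. -/
def signMap : (⨁ d, H d) →ₗ[k] ⨁ d, H d :=
  DirectSum.lmap (fun d : ℤ => d.negOnePow • (LinearMap.id : H d →ₗ[k] H d))

variable {k H}

theorem lof_mem_piece (e : ℤ) (x : H e) : DirectSum.lof k ℤ H e x ∈ piece k H e := ⟨x, rfl⟩

theorem iSup_piece : ⨆ e, piece k H e = ⊤ :=
  eq_top_iff.mpr fun x _ => by
    induction x using DirectSum.induction_on with
    | zero => exact zero_mem _
    | of e x => exact Submodule.mem_iSup_of_mem e (lof_mem_piece e x)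
    | add x y hx hy => exact add_mem (hx trivial) (hy trivial)

theorem isSign_signMap : IsSign (piece k H) (signMap k H) := by
  rintro e _ ⟨x, rfl⟩
  rw [signMap, DirectSum.lmap_lof, LinearMap.smul_apply, Units.smul_def, Units.smul_def,
    map_zsmul, LinearMap.id_apply]

theorem hasDegree_lmap (g : ∀ d, H d →ₗ[k] H' d) :
    HasDegree (piece k H) (piece k H') (DirectSum.lmap g) 0 := by
  rintro e _ ⟨x, rfl⟩
  rw [add_zero, DirectSum.lmap_lof]
  exact lof_mem_piece _ _

theorem mem_piece_iff {e : ℤ} {x : ⨁ d, H d} : x ∈ piece k H e ↔ ∀ d, d ≠ e → x d = 0 := by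
  constructor
  · rintro ⟨x, rfl⟩ d hd
    exact DirectSum.of_eq_of_ne _ _ _ hd
  · refine fun h => ⟨x e, DirectSum.ext_component k fun d => ?_⟩
    by_cases hd : d = e
    · subst hd; exact DirectSum.component.lof_self k d _
    · exact (DirectSum.of_eq_of_ne _ _ _ hd).trans (h d hd).symm

theorem HasDegree.apply_lof {f : (⨁ d, H d) →ₗ[k] ⨁ d, H' d} {r : ℤ}
    (hf : HasDegree (piece k H) (piece k H') f r) {d e : ℤ} (h : d + r = e) (x : H d) :
    f (DirectSum.lof k ℤ H d x) = DirectSum.lof k ℤ H' e (f (DirectSum.lof k ℤ H d x) e) := by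
  subst h
  obtain ⟨y, hy⟩ := hf d _ (lof_mem_piece d x)
  rw [← hy]
  exact congrArg _ (DirectSum.component.lof_self k _ y).symm

theorem HasDegree.apply_lof_apply {f : (⨁ d, H d) →ₗ[k] ⨁ d, H' d}
    (hf : HasDegree (piece k H) (piece k H') f 0) (x : ⨁ d, H d) (e : ℤ) :
    f (DirectSum.lof k ℤ H e (x e)) = DirectSum.lof k ℤ H' e (f x e) := by
  induction x using DirectSum.induction_on with
  | zero => simp
  | add x y hx hy => simp only [DirectSum.add_apply, map_add, hx, hy]
  | of d x =>
    change f (DirectSum.lof k ℤ H e (DirectSum.lof k ℤ H d x e)) =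
      DirectSum.lof k ℤ H' e (f (DirectSum.lof k ℤ H d x) e)
    obtain rfl | hd := eq_or_ne d e
    · rw [← hf.apply_lof (add_zero d) x]
      exact congrArg _ (congrArg _ (DirectSum.component.lof_self k d x))
    · rw [mem_piece_iff.mp (lof_mem_piece d x) e hd.symm,
        mem_piece_iff.mp (hf.mem (lof_mem_piece d x)) e hd.symm, map_zero, map_zero, map_zero]

theorem HasDegree.symm {f : (⨁ d, H d) ≃ₗ[k] ⨁ d, H' d}
    (hf : HasDegree (piece k H) (piece k H') f.toLinearMap 0) :
    HasDegree (piece k H') (piece k H) f.symm.toLinearMap 0 := by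
  intro e x hx
  obtain ⟨y, rfl⟩ := f.surjective x
  rw [add_zero, LinearEquiv.coe_coe, LinearEquiv.symm_apply_apply]
  refine mem_piece_iff.mpr fun d hd => ?_
  have h : f (DirectSum.lof k ℤ H d (y d)) = 0 :=
    (hf.apply_lof_apply y d).trans (by simp [mem_piece_iff.mp hx d hd])
  exact DirectSum.of_injective (β := H) d (((map_eq_zero_iff f f.injective).mp h).trans
    (map_zero _).symm)

end DirectSum

section TensorDegree

variable {k : Type v} [Field k] {H : ℤ → Type u} [∀ d, AddCommGroup (H d)] [∀ d, Module k (H d)]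
  {H' : ℤ → Type u'} [∀ d, AddCommGroup (H' d)] [∀ d, Module k (H' d)]

theorem one_mem_tensorDegree : (1 : TensorCoalg k H) ∈ tensorDegree k H 0 :=
  Submodule.subset_span ⟨0, Fin.elim0, fun i => i.elim0, by simp, by simp⟩

theorem ι_mul_mem_tensorDegree {e d : ℤ} {a : ⨁ d, H d} (ha : a ∈ piece k H e)
    {x : TensorCoalg k H} (hx : x ∈ tensorDegree k H d) : ι k a * x ∈ tensorDegree k H (e + d) := by
  obtain ⟨a, rfl⟩ := ha
  induction hx using Submodule.span_induction with
  | zero => rw [mul_zero]; exact zero_mem _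
  | add x y _ _ hx hy => rw [mul_add]; exact add_mem hx hy
  | smul c x _ hx => rw [mul_smul_comm]; exact Submodule.smul_mem _ c hx
  | mem x hx =>
    obtain ⟨n, f, o, rfl, rfl⟩ := hx
    refine Submodule.subset_span ⟨n + 1, Fin.cons e f,
      Fin.cases (motive := fun i => H (Fin.cons (α := fun _ => ℤ) e f i)) a o, ?_, ?_⟩
    · simp [Fin.sum_univ_succ]
    · simp only [TensorAlgebra.tprod_apply, List.ofFn_succ, List.prod_cons]
      rfl

theorem tensorDegree_le {U : ℤ → Submodule k (TensorCoalg k H)} (one : 1 ∈ U 0)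
    (ι_mul : ∀ e, ∀ a ∈ piece k H e, ∀ d, ∀ x ∈ tensorDegree k H d, x ∈ U d →
      ι k a * x ∈ U (e + d)) (d : ℤ) : tensorDegree k H d ≤ U d := by
  refine Submodule.span_le.mpr ?_
  rintro _ ⟨n, e, o, rfl, rfl⟩
  induction n with
  | zero => simpa using one
  | succ n ih =>
    rw [Fin.sum_univ_succ, TensorAlgebra.tprod_apply, List.ofFn_succ, List.prod_cons,
      ← TensorAlgebra.tprod_apply]
    exact ι_mul _ _ (lof_mem_piece _ _) _ _ (Submodule.subset_span ⟨n, _, _, rfl, rfl⟩) (ih _ _)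

theorem ι_mem_tensorDegree {e : ℤ} {a : ⨁ d, H d} (ha : a ∈ piece k H e) :
    ι k a ∈ tensorDegree k H e := by
  simpa using ι_mul_mem_tensorDegree ha one_mem_tensorDegree

theorem iSup_tensorDegree : ⨆ d, tensorDegree k H d = ⊤ := by
  refine eq_top_iff.mpr fun x _ => ?_
  induction x using ι_mul_induction with
  | one => exact Submodule.mem_iSup_of_mem 0 one_mem_tensorDegree
  | add x y hx hy => exact add_mem (hx trivial) (hy trivial)
  | smul c x hx => exact Submodule.smul_mem _ c (hx trivial)
  | ι_mul a x hx =>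
    have ha : a ∈ ⨆ e, piece k H e := by
      rw [iSup_piece]; exact Submodule.mem_top
    refine Submodule.iSup_induction (piece k H)
      (motive := fun a => ι k a * x ∈ ⨆ d, tensorDegree k H d) ha
      (fun e a ha => ?_) (by simp) fun a b ha hb => ?_
    · refine Submodule.iSup_induction (tensorDegree k H)
        (motive := fun x => ι k a * x ∈ ⨆ d, tensorDegree k H d) (hx trivial)
        (fun d x hx => Submodule.mem_iSup_of_mem _ (ι_mul_mem_tensorDegree ha hx)) (by simp)
        fun x y hx hy => ?_
      rw [mul_add]
      exact add_mem hx hy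
    · rw [map_add, add_mul]
      exact add_mem ha hb

theorem koszulSign_eq_tmap : koszulSign k H = (tmap (signMap k H)).toLinearMap := rfl

theorem isSign_koszulSign : IsSign (tensorDegree k H) (koszulSign k H) := by
  refine tensorDegree_le (U := fun d => LinearMap.eqLocus (koszulSign k H)
      (d.negOnePow • (LinearMap.id : TensorCoalg k H →ₗ[k] TensorCoalg k H))) ?_
    fun e a ha d x _ hx => ?_
  · simp [LinearMap.mem_eqLocus, koszulSign_eq_tmap]
  · simp only [LinearMap.mem_eqLocus, koszulSign_eq_tmap, AlgHom.toLinearMap_apply,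
      LinearMap.smul_apply, LinearMap.id_apply] at hx ⊢
    rw [map_mul, tmap_ι, hx, isSign_signMap e a ha, Int.negOnePow_add, Units.smul_def,
      Units.smul_def, Units.smul_def, map_zsmul, smul_mul_smul_comm, Units.val_mul]

theorem algebraMapInv_eq_zero_of_mem_tensorDegree {d : ℤ} (hd : d ≠ 0) {x : TensorCoalg k H}
    (hx : x ∈ tensorDegree k H d) : algebraMapInv x = 0 :=
  (Submodule.mem_iInf _).mp (tensorDegree_le (U := fun d => ⨅ _ : d ≠ 0,
      LinearMap.ker (algebraMapInv : TensorCoalg k H →ₐ[k] k).toLinearMap) (by simp)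
    (fun e a _ d x _ _ => by simp [Submodule.mem_iInf]) d hx) hd

theorem hasDegree_ιInv : HasDegree (tensorDegree k H) (piece k H) ιInv 0 := fun d => by
  rw [add_zero]
  refine tensorDegree_le (U := fun d => (piece k H d).comap ιInv) (by simp)
    (fun e a ha d x hx _ => ?_) d
  obtain rfl | hd := eq_or_ne d 0
  · simpa using Submodule.smul_mem _ _ ha
  · simp [algebraMapInv_eq_zero_of_mem_tensorDegree hd hx]

theorem hasDegree_tmap {g : (⨁ d, H d) →ₗ[k] ⨁ d, H' d}
    (hg : HasDegree (piece k H) (piece k H') g 0) :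
    HasDegree (tensorDegree k H) (tensorDegree k H') (tmap g).toLinearMap 0 := fun d => by
  rw [add_zero]
  refine tensorDegree_le (U := fun d => (tensorDegree k H' d).comap (tmap g).toLinearMap) ?_
    (fun e a ha d x _ hx => ?_) d
  · simpa using one_mem_tensorDegree
  · simpa using ι_mul_mem_tensorDegree (hg.mem ha) hx

theorem hasDegree_skewDerivation {α g β : (⨁ d, H d) →ₗ[k] ⨁ d, H' d} {r : ℤ}
    (hα : HasDegree (piece k H) (piece k H') α 0) (hg : HasDegree (piece k H) (piece k H') g r)
    (hβ : HasDegree (piece k H) (piece k H') β 0) :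
    HasDegree (tensorDegree k H) (tensorDegree k H') (skewDerivation α g β) r := fun d =>
  tensorDegree_le (U := fun d => (tensorDegree k H' (d + r)).comap (skewDerivation α g β)) (by simp)
    (fun e a ha d x hx hx' => by
      rw [Submodule.mem_comap, skewDerivation_ι_mul]
      refine add_mem ?_ ?_
      · simpa only [add_right_comm, AlgHom.toLinearMap_apply] using
          ι_mul_mem_tensorDegree (hg e a ha) ((hasDegree_tmap hβ).mem hx)
      · simpa only [add_assoc] using ι_mul_mem_tensorDegree (hα.mem ha) hx') d

variable (k H H') in
/-- The part of `C(H) ⊗ C(H')` of total degree `d`. -/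
def tensorDegree₂ (d : ℤ) : Submodule k (TensorCoalg k H ⊗[k] TensorCoalg k H') :=
  Submodule.span k {z | ∃ e c : ℤ, e + c = d ∧ ∃ u ∈ tensorDegree k H e,
    ∃ w ∈ tensorDegree k H' c, z = u ⊗ₜ[k] w}

theorem tmul_mem_tensorDegree₂ {e c : ℤ} {u : TensorCoalg k H} (hu : u ∈ tensorDegree k H e)
    {w : TensorCoalg k H'} (hw : w ∈ tensorDegree k H' c) :
    u ⊗ₜ[k] w ∈ tensorDegree₂ k H H' (e + c) :=
  Submodule.subset_span ⟨e, c, rfl, u, hu, w, hw, rfl⟩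

theorem tensorDegree₂_le {d : ℤ} {U : Submodule k (TensorCoalg k H ⊗[k] TensorCoalg k H')}
    (tmul : ∀ e c, e + c = d → ∀ u ∈ tensorDegree k H e, ∀ w ∈ tensorDegree k H' c,
      u ⊗ₜ[k] w ∈ U) : tensorDegree₂ k H H' d ≤ U := by
  refine Submodule.span_le.mpr ?_
  rintro _ ⟨e, c, h, u, hu, w, hw, rfl⟩
  exact tmul e c h u hu w hw

variable {f : TensorCoalg k H →ₗ[k] ⨁ d, H' d}

theorem prepend_mem_tensorDegree (hf : HasDegree (tensorDegree k H) (piece k H') f 0) {e d : ℤ}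
    {a : ⨁ d, H d} (ha : a ∈ piece k H e) {z : TensorCoalg k H ⊗[k] TensorCoalg k H'}
    (hz : z ∈ tensorDegree₂ k H H' d) : prepend f a z ∈ tensorDegree k H' (e + d) := by
  refine tensorDegree₂_le (U := (tensorDegree k H' (e + d)).comap (prepend f a)) ?_ hz
  rintro c c' rfl u hu w hw
  simpa only [Submodule.mem_comap, prepend_tmul, add_assoc] using
    ι_mul_mem_tensorDegree (hf.mem (ι_mul_mem_tensorDegree ha hu)) hw

theorem hasDegree_coalgLiftState (hf : HasDegree (tensorDegree k H) (piece k H') f 0) :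
    HasDegree (tensorDegree k H) (tensorDegree₂ k H H') (coalgLiftState f) 0 := fun d => by
  rw [add_zero]
  refine tensorDegree_le (U := fun d => (tensorDegree₂ k H H' d).comap (coalgLiftState f)) ?_
    (fun e a ha d x _ hx => ?_) d
  · simpa using tmul_mem_tensorDegree₂ one_mem_tensorDegree one_mem_tensorDegree
  · rw [Submodule.mem_comap, coalgLiftState_ι_mul]
    refine add_mem ?_ ?_
    · simpa using tmul_mem_tensorDegree₂ one_mem_tensorDegree (prepend_mem_tensorDegree hf ha hx)
    · refine tensorDegree₂_le (U := (tensorDegree₂ k H H' (e + d)).comap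
        ((LinearMap.mulLeft k (ι k a)).rTensor _)) ?_ hx
      rintro c c' rfl u hu w hw
      simpa only [Submodule.mem_comap, LinearMap.rTensor_tmul, LinearMap.mulLeft_apply,
        add_assoc] using tmul_mem_tensorDegree₂ (ι_mul_mem_tensorDegree ha hu) hw

theorem hasDegree_coalgLift (hf : HasDegree (tensorDegree k H) (piece k H') f 0) :
    HasDegree (tensorDegree k H) (tensorDegree k H') (coalgLift f) 0 := fun d => by
  rw [add_zero]
  refine tensorDegree_le (U := fun d => (tensorDegree k H' d).comap (coalgLift f)) ?_
    (fun e a ha d x hx _ => ?_) d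
  · simpa using one_mem_tensorDegree
  · rw [Submodule.mem_comap, coalgLift_ι_mul_eq_state]
    exact prepend_mem_tensorDegree hf ha ((hasDegree_coalgLiftState hf).mem hx)

end TensorDegree

section Splitting

variable {k : Type v} [CommRing k] {H : ℤ → Type u} [∀ d, AddCommGroup (H d)] [∀ d, Module k (H d)]

theorem HasDegree.exists_split_idempotent {P : Module.End k (⨁ d, H d)}
    (hP : HasDegree (piece k H) (piece k H) P 0) (hPP : ∀ x, P (P x) = P x) :
    ∃ (A : ℤ → Type u) (_ : ∀ d, AddCommGroup (A d)) (_ : ∀ d, Module k (A d))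
      (p : (⨁ d, H d) →ₗ[k] ⨁ d, A d) (i : (⨁ d, A d) →ₗ[k] ⨁ d, H d),
      HasDegree (piece k H) (piece k A) p 0 ∧ HasDegree (piece k A) (piece k H) i 0 ∧
        (∀ x, p (i x) = x) ∧ ∀ x, i (p x) = P x := by
  let Q : ∀ e, H e →ₗ[k] H e := fun e =>
    DirectSum.component k ℤ H e ∘ₗ P ∘ₗ DirectSum.lof k ℤ H e
  have P_lof : ∀ e x, P (DirectSum.lof k ℤ H e x) = DirectSum.lof k ℤ H e (Q e x) := fun e =>
    hP.apply_lof (add_zero e)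
  have Q_Q : ∀ e x, Q e (Q e x) = Q e x := fun e x =>
    DirectSum.of_injective (β := H) e <| by
      change DirectSum.lof k ℤ H e _ = DirectSum.lof k ℤ H e _
      rw [← P_lof, ← P_lof, hPP]
  let p := DirectSum.lmap fun e => (Q e).rangeRestrict
  let i := DirectSum.lmap fun e => (LinearMap.range (Q e)).subtype
  have p_i : p ∘ₗ i = LinearMap.id := DirectSum.linearMap_ext k fun e => by
    ext1 ⟨_, y, rfl⟩
    simp only [p, i, LinearMap.comp_apply, DirectSum.lmap_lof]
    exact congrArg _ (Subtype.ext (Q_Q e y))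
  have i_p : i ∘ₗ p = P := DirectSum.linearMap_ext k fun e => by
    ext1 x
    simp only [p, i, LinearMap.comp_apply, DirectSum.lmap_lof, P_lof]
    rfl
  exact ⟨fun e => LinearMap.range (Q e), inferInstance, inferInstance, p, i, hasDegree_lmap _,
    hasDegree_lmap _, LinearMap.congr_fun p_i, LinearMap.congr_fun i_p⟩

/-- A graded splitting of the complex `(⨁ d, H d, d)`: a contraction onto `A` together with a
complement `B` of `A` in `H`, with inclusion `j` and projection `b`. -/
structure IsSplitting {A B : ℤ → Type*} [∀ d, AddCommGroup (A d)] [∀ d, Module k (A d)]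
    [∀ d, AddCommGroup (B d)] [∀ d, Module k (B d)] (d h : Module.End k (⨁ d, H d))
    (p : (⨁ d, H d) →ₗ[k] ⨁ d, A d) (i : (⨁ d, A d) →ₗ[k] ⨁ d, H d)
    (b : (⨁ d, H d) →ₗ[k] ⨁ d, B d) (j : (⨁ d, B d) →ₗ[k] ⨁ d, H d) : Prop
    extends IsContraction d h p i where
  b_j : ∀ x, b (j x) = x
  i_p_add_j_b : ∀ x, i (p x) + j (b x) = x
  hasDegree_h : HasDegree (piece k H) (piece k H) h (-1)
  hasDegree_p : HasDegree (piece k H) (piece k A) p 0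
  hasDegree_i : HasDegree (piece k A) (piece k H) i 0
  hasDegree_b : HasDegree (piece k H) (piece k B) b 0
  hasDegree_j : HasDegree (piece k B) (piece k H) j 0

namespace IsSplitting

variable {A B : ℤ → Type*} [∀ d, AddCommGroup (A d)] [∀ d, Module k (A d)]
  [∀ d, AddCommGroup (B d)] [∀ d, Module k (B d)] {d h : Module.End k (⨁ d, H d)}
  {p : (⨁ d, H d) →ₗ[k] ⨁ d, A d} {i : (⨁ d, A d) →ₗ[k] ⨁ d, H d}
  {b : (⨁ d, H d) →ₗ[k] ⨁ d, B d} {j : (⨁ d, B d) →ₗ[k] ⨁ d, H d}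

theorem j_b (C : IsSplitting d h p i b j) (x : ⨁ d, H d) : j (b x) = d (h x) + h (d x) := by
  rw [C.homotopy, eq_sub_iff_add_eq', C.i_p_add_j_b]

theorem d_h_d (C : IsSplitting d h p i b j) (x : ⨁ d, H d) : d (h (d x)) = d x := by
  simpa [C.d_d, C.p_d] using C.homotopy (d x)

theorem p_j (C : IsSplitting d h p i b j) (x : ⨁ d, B d) : p (j x) = 0 := by
  rw [← C.b_j x, C.j_b, map_add, C.p_d, C.p_h, add_zero]

theorem b_i (C : IsSplitting d h p i b j) (x : ⨁ d, A d) : b (i x) = 0 := by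
  simpa [C.p_i, C.b_j] using congrArg b (C.i_p_add_j_b (i x))

end IsSplitting

end Splitting

section Field

variable {k : Type v} [Field k] {H : ℤ → Type u} [∀ d, AddCommGroup (H d)] [∀ d, Module k (H d)]

theorem exists_generalizedInverse {U W : Type*} [AddCommGroup U] [Module k U] [AddCommGroup W]
    [Module k W] (f : U →ₗ[k] W) : ∃ g : W →ₗ[k] U, ∀ x, f (g (f x)) = f x := by
  obtain ⟨s, hs⟩ := f.rangeRestrict.exists_rightInverse_of_surjective f.range_rangeRestrict
  obtain ⟨t, ht⟩ := (LinearMap.range f).subtype.exists_leftInverse_of_injective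
    (Submodule.ker_subtype _)
  refine ⟨s ∘ₗ t, fun x => ?_⟩
  have t_f : t (f x) = f.rangeRestrict x := LinearMap.congr_fun ht (f.rangeRestrict x)
  rw [LinearMap.comp_apply, t_f]
  exact congrArg Subtype.val (LinearMap.congr_fun hs (f.rangeRestrict x))

theorem HasDegree.exists_generalizedInverse {H' : ℤ → Type u'} [∀ d, AddCommGroup (H' d)]
    [∀ d, Module k (H' d)] {f : (⨁ d, H d) →ₗ[k] ⨁ d, H' d} {r : ℤ}
    (hf : HasDegree (piece k H) (piece k H') f r) :
    ∃ g : (⨁ d, H' d) →ₗ[k] ⨁ d, H d,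
      HasDegree (piece k H') (piece k H) g (-r) ∧ ∀ x, f (g (f x)) = f x := by
  choose g hg using fun e : ℤ => AInfinity.exists_generalizedInverse
    (DirectSum.component k ℤ H' e ∘ₗ f ∘ₗ DirectSum.lof k ℤ H (e - r))
  have f_lof : ∀ e (x : H (e - r)), f (DirectSum.lof k ℤ H (e - r) x) =
      DirectSum.lof k ℤ H' e (f (DirectSum.lof k ℤ H (e - r) x) e) := fun e =>
    hf.apply_lof (sub_add_cancel e r)
  let G := DirectSum.toModule k ℤ _ fun e => DirectSum.lof k ℤ H (e - r) ∘ₗ g e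
  refine ⟨G, ?_, LinearMap.congr_fun (f := f ∘ₗ G ∘ₗ f) (DirectSum.linearMap_ext k fun c => ?_)⟩
  · rintro e _ ⟨x, rfl⟩
    rw [DirectSum.toModule_lof]
    exact lof_mem_piece (e - r) _
  · obtain ⟨e, rfl⟩ : ∃ e, c = e - r := ⟨c + r, (add_sub_cancel_right c r).symm⟩
    ext1 x
    simp only [G, LinearMap.comp_apply]
    rw [f_lof e x, DirectSum.toModule_lof, LinearMap.comp_apply, f_lof e]
    exact congrArg _ (hg e x)

theorem exists_homotopy {d : Module.End k (⨁ d, H d)}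
    (hd : HasDegree (piece k H) (piece k H) d 1) (hdd : ∀ x, d (d x) = 0) :
    ∃ h : Module.End k (⨁ d, H d), HasDegree (piece k H) (piece k H) h (-1) ∧
      (∀ x, d (h (d x)) = d x) ∧ (∀ x, h (d (h x)) = h x) ∧ ∀ x, h (h x) = 0 := by
  obtain ⟨g, hg, d_g_d⟩ := hd.exists_generalizedInverse
  have g_d_g : HasDegree (piece k H) (piece k H) (g ∘ₗ d ∘ₗ g) (-1) := hg.comp (hd.comp hg rfl) rfl
  -- `g d g` also satisfies `h d h = h`; the correction term makes the square vanish.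
  exact ⟨g ∘ₗ d ∘ₗ g - d ∘ₗ (g ∘ₗ d ∘ₗ g) ∘ₗ g ∘ₗ d ∘ₗ g,
    g_d_g.sub (hd.comp (g_d_g.comp g_d_g rfl) rfl), fun x => by simp [hdd, d_g_d],
    fun x => by simp [hdd, d_g_d], fun x => by simp [d_g_d]⟩

theorem exists_isSplitting {d : Module.End k (⨁ d, H d)}
    (hd : HasDegree (piece k H) (piece k H) d 1) (hdd : ∀ x, d (d x) = 0) :
    ∃ (A B : ℤ → Type u) (_ : ∀ d, AddCommGroup (A d)) (_ : ∀ d, Module k (A d))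
      (_ : ∀ d, AddCommGroup (B d)) (_ : ∀ d, Module k (B d)) (h : Module.End k (⨁ d, H d))
      (p : (⨁ d, H d) →ₗ[k] ⨁ d, A d) (i : (⨁ d, A d) →ₗ[k] ⨁ d, H d)
      (b : (⨁ d, H d) →ₗ[k] ⨁ d, B d) (j : (⨁ d, B d) →ₗ[k] ⨁ d, H d),
      IsSplitting d h p i b j := by
  obtain ⟨h, hh, d_h_d, h_d_h, h_h⟩ := exists_homotopy hd hdd
  have hQ : HasDegree (piece k H) (piece k H) (d ∘ₗ h + h ∘ₗ d) 0 :=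
    (hd.comp hh rfl).add (hh.comp hd rfl)
  obtain ⟨A, _, _, p, i, hp, hi, p_i, i_p⟩ := (HasDegree.id.sub hQ).exists_split_idempotent
    fun x => by simp [hdd, h_h, d_h_d, h_d_h]
  obtain ⟨B, _, _, b, j, hb, hj, b_j, j_b⟩ := hQ.exists_split_idempotent
    fun x => by simp [hdd, h_h, d_h_d, h_d_h]
  have i_injective : Function.Injective i := Function.LeftInverse.injective p_i
  exact ⟨A, B, _, _, _, _, h, p, i, b, j,
    { d_d := hdd
      homotopy := fun x => by simp [i_p]
      h_h := h_h
      h_i := fun x => by rw [← p_i x, i_p]; simp [h_h, h_d_h]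
      p_h := fun x => i_injective (by rw [i_p]; simp [h_h, h_d_h])
      p_d := fun x => i_injective (by rw [i_p]; simp [hdd, d_h_d])
      d_i := fun x => by rw [← p_i x, i_p]; simp [hdd, d_h_d]
      p_i := p_i
      b_j := b_j
      i_p_add_j_b := fun x => by simp [i_p, j_b]
      hasDegree_h := hh
      hasDegree_p := hp
      hasDegree_i := hi
      hasDegree_b := hb
      hasDegree_j := hj }⟩

end Field

section Structures

variable {k : Type v} [Field k] {H : ℤ → Type u} [∀ d, AddCommGroup (H d)] [∀ d, Module k (H d)]
  {H' : ℤ → Type u'} [∀ d, AddCommGroup (H' d)] [∀ d, Module k (H' d)]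

theorem component_apply (F : TensorCoalg k H →ₗ[k] TensorCoalg k H') (n : ℕ)
    (o : Fin n → ⨁ d, H d) : component F n o = ιInv (F (word k (List.ofFn o))) := by
  simp only [component, LinearMap.compMultilinearMap_apply, LinearMap.comp_apply,
    TensorAlgebra.tprod_apply, word, List.map_ofFn]
  rfl

theorem component_zero_eq_zero_iff {F : TensorCoalg k H →ₗ[k] TensorCoalg k H'} :
    component F 0 = 0 ↔ ιInv (F 1) = 0 := by
  refine ⟨fun h => ?_, fun h => MultilinearMap.ext fun o => ?_⟩
  · simpa [component_apply] using congrArg (fun f => f Fin.elim0) h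
  · simpa [component_apply] using h

theorem counit_koszulSign (x : TensorCoalg k H) :
    algebraMapInv (koszulSign k H x) = algebraMapInv x := algebraMapInv_tmap _ x

theorem koszulSign_koszulSign (x : TensorCoalg k H) : koszulSign k H (koszulSign k H x) = x :=
  isSign_koszulSign.apply_apply iSup_tensorDegree x

theorem signMap_signMap (a : ⨁ d, H d) : signMap k H (signMap k H a) = a :=
  isSign_signMap.apply_apply iSup_piece a

theorem HasDegree.koszulSign_apply {F : TensorCoalg k H →ₗ[k] TensorCoalg k H'}
    (hF : HasDegree (tensorDegree k H) (tensorDegree k H') F 0) (x : TensorCoalg k H) :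
    F (koszulSign k H x) = koszulSign k H' (F x) := by
  simpa using (hF.sign_apply iSup_tensorDegree isSign_koszulSign isSign_koszulSign x).symm

theorem HasDegree.signMap_apply {d : Module.End k (⨁ d, H d)}
    (hd : HasDegree (piece k H) (piece k H) d 1) (a : ⨁ d, H d) :
    signMap k H (d a) = -d (signMap k H a) := by
  simpa [Units.smul_def] using hd.sign_apply iSup_piece isSign_signMap isSign_signMap a

theorem isCoderivation_skewDerivation_signMap (d : Module.End k (⨁ d, H d)) :
    IsCoderivation (koszulSign k H) LinearMap.id
      (skewDerivation (signMap k H) d LinearMap.id) := by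
  simpa [koszulSign_eq_tmap, tmap_id] using
    isCoderivation_skewDerivation (signMap k H) d LinearMap.id

namespace AInfinityAlgebra

theorem isCoderivation (X : AInfinityAlgebra k H) :
    IsCoderivation (koszulSign k H) LinearMap.id X.codiff :=
  LinearMap.congr_fun X.coderivation

theorem codiff_codiff (X : AInfinityAlgebra k H) (x : TensorCoalg k H) :
    X.codiff (X.codiff x) = 0 :=
  LinearMap.congr_fun X.sq_zero x

theorem codiff_one (X : AInfinityAlgebra k H) : X.codiff 1 = 0 :=
  X.isCoderivation.map_one counit_koszulSign (fun _ => rfl) (by simp [koszulSign_eq_tmap])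
    (component_zero_eq_zero_iff.mp X.component_zero)

/-- The operation `m₁`, as an endomorphism of `H`. -/
def differential (X : AInfinityAlgebra k H) : Module.End k (⨁ d, H d) :=
  ιInv ∘ₗ X.codiff ∘ₗ ι k

theorem m_one_apply (X : AInfinityAlgebra k H) (o : Fin 1 → ⨁ d, H d) :
    X.m 1 o = X.differential (o 0) := by
  simp [m, component_apply, differential, List.ofFn_succ]

theorem codiff_ι (X : AInfinityAlgebra k H) (a : ⨁ d, H d) :
    X.codiff (ι k a) = ι k (X.differential a) := by
  rw [X.isCoderivation.first_letter counit_koszulSign fun _ => rfl,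
    show ι k a = ι k a * 1 from (mul_one _).symm, deconcat_ι_mul]
  simp [deconcat_one, koszulSign_eq_tmap, codiff_one, differential]

theorem differential_differential (X : AInfinityAlgebra k H) (a : ⨁ d, H d) :
    X.differential (X.differential a) = 0 := by
  simpa [codiff_ι] using congrArg ιInv (X.codiff_codiff (ι k a))

theorem hasDegree_differential (X : AInfinityAlgebra k H) :
    HasDegree (piece k H) (piece k H) X.differential 1 :=
  fun _ _ ha => hasDegree_ιInv.mem (X.degree_one _ _ (ι_mem_tensorDegree ha))

theorem lowersLength_codiff_sub (X : AInfinityAlgebra k H) :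
    LowersLength (X.codiff - skewDerivation (signMap k H) X.differential LinearMap.id) :=
  IsCoderivation.lowersLength (α := signMap k H)
    (X.isCoderivation.sub (isCoderivation_skewDerivation_signMap X.differential))
    (by simp [codiff_one]) fun a => by simp [codiff_ι]

/-- The `A∞`-structure with codifferential `c` on the target of a surjective coalgebra homomorphism
`G` out of an `A∞`-algebra, where `G` intertwines the two codifferentials. -/
def push (X : AInfinityAlgebra k H) {G : TensorCoalg k H →ₗ[k] TensorCoalg k H'}
    {c : Module.End k (TensorCoalg k H')} (hG : IsCoalgHom G)
    (hGdeg : HasDegree (tensorDegree k H) (tensorDegree k H') G 0) (hG1 : G 1 = 1)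
    (surj : Function.Surjective G)
    (hcdeg : HasDegree (tensorDegree k H') (tensorDegree k H') c 1)
    (comm : ∀ x, c (G x) = G (X.codiff x)) : AInfinityAlgebra k H' where
  codiff := c
  degree_one := hcdeg
  coderivation := LinearMap.ext <| IsCoderivation.of_comp hG surj <| by
    have hG_sign : koszulSign k H' ∘ₗ G = G ∘ₗ koszulSign k H :=
      LinearMap.ext fun x => (hGdeg.koszulSign_apply x).symm
    rw [hG_sign, show c ∘ₗ G = G ∘ₗ X.codiff from LinearMap.ext comm]
    exact X.isCoderivation.isCoalgHom_comp hG
  sq_zero := LinearMap.ext fun y => by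
    obtain ⟨x, rfl⟩ := surj y
    rw [LinearMap.comp_apply, comm, comm, codiff_codiff, map_zero, LinearMap.zero_apply]
  component_zero := component_zero_eq_zero_iff.mpr (by rw [← hG1, comm, codiff_one]; simp)

/-- A complex, regarded as an `A∞`-algebra without higher operations. -/
def ofDifferential {d : Module.End k (⨁ d, H d)} (hd : HasDegree (piece k H) (piece k H) d 1)
    (hdd : ∀ x, d (d x) = 0) : AInfinityAlgebra k H where
  codiff := skewDerivation (signMap k H) d LinearMap.id
  degree_one := hasDegree_skewDerivation (hasDegree_lmap _) hd .id
  coderivation := LinearMap.ext (isCoderivation_skewDerivation_signMap d)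
  sq_zero := LinearMap.ext <| skewDerivation_skewDerivation_eq_zero hdd hd.signMap_apply
  component_zero := component_zero_eq_zero_iff.mpr (by simp)

theorem ofDifferential_m {d : Module.End k (⨁ d, H d)}
    (hd : HasDegree (piece k H) (piece k H) d 1) (hdd : ∀ x, d (d x) = 0) (n : ℕ)
    (o : Fin n → ⨁ d, H d) :
    (ofDifferential hd hdd).m n o = d (ιInv (word k (List.ofFn o))) := by
  rw [m, component_apply]
  exact ιInv_skewDerivation _ _ _ _

theorem isLinearContractible_ofDifferential {d : Module.End k (⨁ d, H d)}
    (hd : HasDegree (piece k H) (piece k H) d 1) (hdd : ∀ x, d (d x) = 0)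
    (acyclic : ∀ x, d x = 0 → ∃ y, d y = x) : (ofDifferential hd hdd).IsLinearContractible := by
  refine ⟨fun n hn => MultilinearMap.ext fun o => ?_, fun x hx => ?_⟩
  · obtain ⟨n, rfl⟩ := Nat.exists_eq_add_of_le' hn
    simp [ofDifferential_m, List.ofFn_succ]
  · simpa [ofDifferential_m] using acyclic x (by simpa [ofDifferential_m] using hx)

theorem m_map_of_tmap_comm {S : AInfinityAlgebra k H} {M : AInfinityAlgebra k H'}
    {g : (⨁ d, H d) →ₗ[k] ⨁ d, H' d} (h : ∀ x, tmap g (S.codiff x) = M.codiff (tmap g x))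
    (n : ℕ) (o : Fin n → ⨁ d, H d) : g (S.m n o) = M.m n fun l => g (o l) := by
  rw [m, m, component_apply, component_apply, ← ιInv_tmap, h, tmap_word, List.map_ofFn]
  rfl

end AInfinityAlgebra

namespace AInfinityMorphism

variable {X : AInfinityAlgebra k H} {Y : AInfinityAlgebra k H'}

theorem isCoalgHom (F : AInfinityMorphism X Y) : IsCoalgHom F.toLinearMap :=
  ⟨F.counit_comp, LinearMap.congr_fun F.deconcat_comp⟩

theorem ιInv_map_one (F : AInfinityMorphism X Y) : ιInv (F.toLinearMap 1) = 0 :=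
  component_zero_eq_zero_iff.mp F.component_zero

theorem hasDegree (F : AInfinityMorphism X Y) :
    HasDegree (tensorDegree k H) (tensorDegree k H') F.toLinearMap 0 :=
  fun d x hx => by simpa using F.degree_zero d x hx

/-- The component `f₁`, as a linear map. -/
def linearPart (F : AInfinityMorphism X Y) : (⨁ d, H d) →ₗ[k] ⨁ d, H' d :=
  ιInv ∘ₗ F.toLinearMap ∘ₗ ι k

theorem isIso_iff {F : AInfinityMorphism X Y} : F.IsIso ↔ Function.Bijective F.linearPart := by
  have f_one : (fun x : ⨁ d, H d => F.f 1 fun _ => x) = F.linearPart := funext fun x => by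
    simp [f, component_apply, linearPart]
  rw [IsIso, f_one]

/-- The `A∞`-morphism given by a degree zero coalgebra homomorphism. -/
def ofIsCoalgHom {F : TensorCoalg k H →ₗ[k] TensorCoalg k H'} (hF : IsCoalgHom F)
    (hdeg : HasDegree (tensorDegree k H) (tensorDegree k H') F 0) (hF1 : F 1 = 1)
    (comm : ∀ x, F (X.codiff x) = Y.codiff (F x)) : AInfinityMorphism X Y where
  toLinearMap := F
  degree_zero _ _ := hdeg.mem
  counit_comp := hF.counit_apply
  deconcat_comp := LinearMap.ext hF.deconcat_apply
  comm := LinearMap.ext comm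
  component_zero := component_zero_eq_zero_iff.mpr (by simp [hF1])

theorem coalgLift_comm {f : TensorCoalg k H →ₗ[k] ⨁ d, H' d}
    (hdeg : HasDegree (tensorDegree k H) (piece k H') f 0) (hf1 : f 1 = 0)
    (h : ∀ x, ιInv (Y.codiff (coalgLift f x)) = f (X.codiff x)) (x : TensorCoalg k H) :
    coalgLift f (X.codiff x) = Y.codiff (coalgLift f x) := by
  set F := coalgLift f
  have hF : IsCoalgHom F := isCoalgHom_coalgLift f
  have F_sign : koszulSign k H' ∘ₗ F = F ∘ₗ koszulSign k H :=
    LinearMap.ext fun x => ((hasDegree_coalgLift hdeg).koszulSign_apply x).symm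
  have defect : IsCoderivation (koszulSign k H' ∘ₗ F) F (F ∘ₗ X.codiff - Y.codiff ∘ₗ F) := by
    have hFX := X.isCoderivation.isCoalgHom_comp hF
    rw [← F_sign] at hFX
    exact hFX.sub (Y.isCoderivation.comp_isCoalgHom hF)
  refine sub_eq_zero.mp (LinearMap.congr_fun (defect.eq_zero ?_ hF.counit_apply ?_ ?_) x)
  · exact fun x => (counit_koszulSign _).trans (hF.counit_apply x)
  · simp [F, koszulSign_eq_tmap]
  · exact LinearMap.ext fun x => by simp [F, h, ιInv_coalgLift hf1]

/-- The `A∞`-morphism with given corestriction `f` to words of length one, which has to satisfy the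
`A∞`-relations `h`. -/
def ofCorestriction {f : TensorCoalg k H →ₗ[k] ⨁ d, H' d}
    (hdeg : HasDegree (tensorDegree k H) (piece k H') f 0) (hf1 : f 1 = 0)
    (h : ∀ x, ιInv (Y.codiff (coalgLift f x)) = f (X.codiff x)) : AInfinityMorphism X Y :=
  ofIsCoalgHom (isCoalgHom_coalgLift f) (hasDegree_coalgLift hdeg) (coalgLift_one f)
    (coalgLift_comm hdeg hf1 h)

end AInfinityMorphism

end Structures

section Decomposition

variable {k : Type v} [Field k] {H : ℤ → Type u} [∀ d, AddCommGroup (H d)] [∀ d, Module k (H d)]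
  {A : ℤ → Type u'} [∀ d, AddCommGroup (A d)] [∀ d, Module k (A d)]

namespace AInfinityAlgebra

/-- The perturbation lemma applied to the tensor trick, with `X.codiff` as a perturbation of the
derivation extending `m₁`. -/
theorem exists_isCoalgHom_of_isContraction (X : AInfinityAlgebra k H)
    {h : Module.End k (⨁ d, H d)} {p : (⨁ d, H d) →ₗ[k] ⨁ d, A d}
    {i : (⨁ d, A d) →ₗ[k] ⨁ d, H d} (C : IsContraction X.differential h p i)
    (hh : HasDegree (piece k H) (piece k H) h (-1)) (hp : HasDegree (piece k H) (piece k A) p 0)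
    (hi : HasDegree (piece k A) (piece k H) i 0) :
    ∃ q : TensorCoalg k H →ₗ[k] TensorCoalg k A, IsCoalgHom q ∧
      HasDegree (tensorDegree k H) (tensorDegree k A) q 0 ∧ q 1 = 1 ∧
      (∀ a, q (ι k a) = ι k (p a)) ∧ (∀ y, q (tmap i y) = y) ∧
      ∀ x, q (X.codiff (tmap i (q x))) = q (X.codiff x) := by
  set D := skewDerivation (signMap k H) X.differential LinearMap.id
  set T := skewDerivation (signMap k H) h (i ∘ₗ p)
  have C' : IsContraction D T (tmap p).toLinearMap (tmap i).toLinearMap :=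
    C.tensorAlgebra signMap_signMap X.hasDegree_differential.signMap_apply
  have hD : HasDegree (tensorDegree k H) (tensorDegree k H) D 1 :=
    hasDegree_skewDerivation (hasDegree_lmap _) X.hasDegree_differential .id
  have hT : HasDegree (tensorDegree k H) (tensorDegree k H) T (-1) :=
    hasDegree_skewDerivation (hasDegree_lmap _) hh (hi.comp hp rfl)
  have hTΔ : IsCoderivation (koszulSign k H) ((tmap i).toLinearMap ∘ₗ (tmap p).toLinearMap) T := by
    simpa [koszulSign_eq_tmap, tmap_comp] using
      isCoderivation_skewDerivation (signMap k H) h (i ∘ₗ p)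
  have hN : IsLocallyNilpotent ((X.codiff - D) ∘ₗ T) :=
    (X.lowersLength_codiff_sub.comp_right fun _ => skewDerivation_mem_lengthLT _ _ _)
      |>.isLocallyNilpotent
  have surj (x) : ∃ y, y + (X.codiff - D) (T y) = x := hN.bijective_one_add.2 x
  obtain ⟨G, hG, G_apply⟩ := hN.exists_hasDegree_leftInverse
    ((HasDegree.sub X.degree_one hD).comp hT (neg_add_cancel 1))
  set q := (tmap p).toLinearMap ∘ₗ G
  have hq (x) : q (x + (X.codiff - D) (T x)) = (tmap p).toLinearMap x :=
    congrArg (tmap p) (G_apply x)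
  have hqdeg : HasDegree (tensorDegree k H) (tensorDegree k A) q 0 :=
    (hasDegree_tmap hp).comp hG rfl
  refine ⟨q, C'.isCoalgHom_perturbed hq surj
    (X.isCoderivation.sub (isCoderivation_skewDerivation_signMap _)) hTΔ (isCoalgHom_tmap p)
    counit_koszulSign koszulSign_koszulSign hqdeg.koszulSign_apply, hqdeg, ?_, fun a => ?_,
    C'.perturbed_i hq, C'.perturbed_comm hq X.codiff_codiff surj⟩
  · simpa [T] using hq 1
  · simpa [T, D, X.codiff_ι] using hq (ι k a)

theorem exists_minimalModel (X : AInfinityAlgebra k H) {h : Module.End k (⨁ d, H d)}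
    {p : (⨁ d, H d) →ₗ[k] ⨁ d, A d} {i : (⨁ d, A d) →ₗ[k] ⨁ d, H d}
    (C : IsContraction X.differential h p i) (hh : HasDegree (piece k H) (piece k H) h (-1))
    (hp : HasDegree (piece k H) (piece k A) p 0) (hi : HasDegree (piece k A) (piece k H) i 0) :
    ∃ (M : AInfinityAlgebra k A) (q : AInfinityMorphism X M), M.IsMinimal ∧ q.linearPart = p := by
  obtain ⟨q, hq, hqdeg, q_one, q_ι, q_tmap, comm⟩ :=
    X.exists_isCoalgHom_of_isContraction C hh hp hi
  let M := X.push (c := q ∘ₗ X.codiff ∘ₗ (tmap i).toLinearMap) hq hqdeg q_one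
    (fun y => ⟨tmap i y, q_tmap y⟩)
    (hqdeg.comp (HasDegree.comp X.degree_one (hasDegree_tmap hi) (zero_add 1)) (add_zero 1)) comm
  refine ⟨M, .ofIsCoalgHom hq hqdeg q_one fun x => (comm x).symm, ?_, LinearMap.ext fun a => ?_⟩
  · have M_differential (a) : M.differential a = 0 := by
      change ιInv (q (X.codiff (tmap i (ι k a)))) = 0
      rw [tmap_ι, X.codiff_ι, C.d_i, map_zero, map_zero, map_zero]
    exact MultilinearMap.ext fun o => (M.m_one_apply o).trans (M_differential _)
  · exact (congrArg ιInv (q_ι a)).trans (ιInv_ι _)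

variable {B : ℤ → Type*} [∀ d, AddCommGroup (B d)] [∀ d, Module k (B d)]

theorem exists_linearContractible_quotient (X : AInfinityAlgebra k H)
    {h : Module.End k (⨁ d, H d)} {p : (⨁ d, H d) →ₗ[k] ⨁ d, A d}
    {i : (⨁ d, A d) →ₗ[k] ⨁ d, H d} {b : (⨁ d, H d) →ₗ[k] ⨁ d, B d}
    {j : (⨁ d, B d) →ₗ[k] ⨁ d, H d} (C : IsSplitting X.differential h p i b j) :
    ∃ (L : AInfinityAlgebra k B) (r : AInfinityMorphism X L),
      L.IsLinearContractible ∧ r.linearPart = b := by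
  set d := X.differential
  have hd : HasDegree (piece k H) (piece k H) d 1 := X.hasDegree_differential
  have hdB : HasDegree (piece k B) (piece k B) (b ∘ₗ d ∘ₗ j) 1 :=
    C.hasDegree_b.comp (hd.comp C.hasDegree_j rfl) rfl
  have hddB (x) : (b ∘ₗ d ∘ₗ j) ((b ∘ₗ d ∘ₗ j) x) = 0 := by simp [C.j_b, C.d_d]
  -- Up to `b`, this is the commutator of the homotopy `h ιInv` with the codifferentials.
  let φ : TensorCoalg k H →ₗ[k] ⨁ d, B d := b ∘ₗ (d ∘ₗ h ∘ₗ ιInv + h ∘ₗ ιInv ∘ₗ X.codiff)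
  have φ_apply (x) : φ x = b (d (h (ιInv x)) + h (ιInv (X.codiff x))) := rfl
  have φ_one : φ 1 = 0 := by simp [φ_apply, X.codiff_one]
  have hφ : HasDegree (tensorDegree k H) (piece k B) φ 0 :=
    C.hasDegree_b.comp ((hd.comp (C.hasDegree_h.comp hasDegree_ιInv rfl) rfl).add
      (C.hasDegree_h.comp (hasDegree_ιInv.comp X.degree_one rfl) rfl)) rfl
  let L := ofDifferential hdB hddB
  have φ_comm (x) : ιInv (L.codiff (coalgLift φ x)) = φ (X.codiff x) := by
    refine (ιInv_skewDerivation _ _ _ _).trans ?_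
    rw [ιInv_coalgLift φ_one]
    simp [φ_apply, C.j_b, C.d_d, C.d_h_d, X.codiff_codiff]
  refine ⟨L, .ofCorestriction hφ φ_one φ_comm,
    isLinearContractible_ofDifferential hdB hddB fun x hx => ⟨b (h (j x)), ?_⟩,
    LinearMap.ext fun a => ?_⟩
  · have d_j : d (j x) = 0 := by
      simpa [C.j_b, C.d_d, C.d_h_d] using congrArg j hx
    have d_h_j : d (h (j x)) = j x := by
      simpa [C.b_j, d_j, eq_comm] using C.j_b (j x)
    simp [C.j_b, C.d_d, d_h_j, C.b_j]
  · have φ_ι : φ (ι k a) = b (j (b a)) := by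
      rw [φ_apply, ιInv_ι, C.j_b]
      rfl
    exact (ιInv_coalgLift φ_one _).trans (φ_ι.trans (C.b_j _))

end AInfinityAlgebra

variable (k A) in
/-- Direct sums of graded vector spaces may be formed degreewise. -/
def directSumProdEquiv (B : ℤ → Type*) [∀ d, AddCommGroup (B d)] [∀ d, Module k (B d)] :
    (⨁ d, A d × B d) ≃ₗ[k] (⨁ d, A d) × ⨁ d, B d :=
  LinearEquiv.ofLinearMap
    ((DirectSum.lmap fun d => LinearMap.fst k (A d) (B d)).prod
      (DirectSum.lmap fun d => LinearMap.snd k (A d) (B d)))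
    ((DirectSum.lmap fun d => LinearMap.inl k (A d) (B d)).coprod
      (DirectSum.lmap fun d => LinearMap.inr k (A d) (B d)))
    (LinearMap.ext fun x => Prod.ext (DFinsupp.ext fun d => by simp)
      (DFinsupp.ext fun d => by simp))
    (LinearMap.ext fun x => DFinsupp.ext fun d => by simp)

/-- The inverse function theorem for `A∞`-morphisms, where `S` is transported along the inverse of
the isomorphism of tensor coalgebras with corestriction `f`. -/
theorem AInfinityAlgebra.exists_isIso_of_bijective (X : AInfinityAlgebra k H)
    {f : TensorCoalg k H →ₗ[k] ⨁ d, A d}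
    (hf : HasDegree (tensorDegree k H) (piece k A) f 0) (hf1 : f 1 = 0)
    (bij : Function.Bijective (f ∘ₗ ι k)) :
    ∃ (S : AInfinityAlgebra k A) (F : AInfinityMorphism X S),
      F.toLinearMap = coalgLift f ∧ Function.Surjective F.toLinearMap ∧ F.IsIso := by
  let e : (⨁ d, H d) ≃ₗ[k] ⨁ d, A d := .ofBijective (f ∘ₗ ι k) bij
  have he : f ∘ₗ ι k = e.toLinearMap := rfl
  have surj : Function.Surjective (coalgLift f) := surjective_coalgLift he
  have hdeg : HasDegree (tensorDegree k H) (tensorDegree k A) (coalgLift f) 0 :=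
    hasDegree_coalgLift hf
  have hι : HasDegree (piece k H) (tensorDegree k H) (ι k) 0 := fun _ _ ha => by
    simpa using ι_mem_tensorDegree ha
  have hsymm : HasDegree (tensorDegree k A) (tensorDegree k H) (tmap e.symm.toLinearMap).toLinearMap
      0 := hasDegree_tmap (HasDegree.symm (f := e) (hf.comp hι rfl))
  obtain ⟨G, hG, G_apply⟩ :=
    (isLocallyNilpotent_tmap_symm_comp_coalgLift_sub_one he).exists_hasDegree_leftInverse
      ((hsymm.comp hdeg rfl).sub .id)
  have leftInverse (x) : G (tmap e.symm.toLinearMap (coalgLift f x)) = x := by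
    simpa using G_apply x
  have comm (x) : (coalgLift f ∘ₗ X.codiff ∘ₗ G ∘ₗ (tmap e.symm.toLinearMap).toLinearMap)
      (coalgLift f x) = coalgLift f (X.codiff x) :=
    congrArg (coalgLift f ∘ₗ X.codiff) (leftInverse x)
  refine ⟨X.push (isCoalgHom_coalgLift f) hdeg (coalgLift_one f) surj
    (hdeg.comp (HasDegree.comp X.degree_one (hG.comp hsymm rfl) rfl) rfl) comm,
    .ofIsCoalgHom (isCoalgHom_coalgLift f) hdeg (coalgLift_one f) fun x => (comm x).symm,
    rfl, surj, AInfinityMorphism.isIso_iff.mpr ?_⟩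
  convert bij
  exact LinearMap.ext fun a => ιInv_coalgLift hf1 _

variable {B : ℤ → Type*} [∀ d, AddCommGroup (B d)] [∀ d, Module k (B d)]

theorem AInfinityMorphism.m_map_of_corestriction {X : AInfinityAlgebra k H}
    {S : AInfinityAlgebra k A} {M : AInfinityAlgebra k B} (F : AInfinityMorphism X S)
    (q : AInfinityMorphism X M) {g : (⨁ d, A d) →ₗ[k] ⨁ d, B d}
    (surj : Function.Surjective F.toLinearMap)
    (h : ∀ x, g (ιInv (F.toLinearMap x)) = ιInv (q.toLinearMap x)) (n : ℕ)
    (o : Fin n → ⨁ d, A d) : g (S.m n o) = M.m n fun l => g (o l) := by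
  have tmap_F (x) : tmap g (F.toLinearMap x) = q.toLinearMap x := by
    refine LinearMap.congr_fun (((isCoalgHom_tmap g).comp F.isCoalgHom).ext q.isCoalgHom
      (q.isCoalgHom.map_one q.ιInv_map_one) (LinearMap.ext fun x => ?_)) x
    simp [h]
  refine AInfinityAlgebra.m_map_of_tmap_comm (fun y => ?_) n o
  obtain ⟨x, rfl⟩ := surj y
  have F_comm := LinearMap.congr_fun F.comm x
  have q_comm := LinearMap.congr_fun q.comm x
  simp only [LinearMap.comp_apply] at F_comm q_comm
  rw [← F_comm, tmap_F, tmap_F, q_comm]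

theorem AInfinityAlgebra.exists_isDirectSum_of_bijective {X : AInfinityAlgebra k H}
    {M : AInfinityAlgebra k A} {L : AInfinityAlgebra k B} (q : AInfinityMorphism X M)
    (r : AInfinityMorphism X L) (bij : Function.Bijective (q.linearPart.prod r.linearPart)) :
    ∃ S : AInfinityAlgebra k (fun d => A d × B d), S.IsDirectSum M L ∧
      ∃ F : AInfinityMorphism X S, F.IsIso := by
  let e := directSumProdEquiv k A B
  let f : TensorCoalg k H →ₗ[k] ⨁ d, A d × B d :=
    e.symm.toLinearMap ∘ₗ (ιInv ∘ₗ q.toLinearMap).prod (ιInv ∘ₗ r.toLinearMap)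
  have e_f (x) : e (f x) = (ιInv (q.toLinearMap x), ιInv (r.toLinearMap x)) :=
    e.apply_symm_apply _
  have hf : HasDegree (tensorDegree k H) (piece k fun d => A d × B d) f 0 :=
    ((hasDegree_lmap _).comp (hasDegree_ιInv.comp q.hasDegree rfl) rfl).add
      ((hasDegree_lmap _).comp (hasDegree_ιInv.comp r.hasDegree rfl) rfl)
  have f_one : f 1 = 0 :=
    e.injective ((e_f 1).trans (by rw [q.ιInv_map_one, r.ιInv_map_one, map_zero]; rfl))
  obtain ⟨S, F, hF, surj, iso⟩ := X.exists_isIso_of_bijective hf f_one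
    (e.symm.bijective.comp bij)
  have e_F (x) : e (ιInv (F.toLinearMap x)) =
      (ιInv (q.toLinearMap x), ιInv (r.toLinearMap x)) := by
    rw [hF, ιInv_coalgLift f_one, e_f]
  exact ⟨S, fun n o => ⟨F.m_map_of_corestriction q surj (fun x => congrArg Prod.fst (e_F x)) n o,
    F.m_map_of_corestriction r surj (fun x => congrArg Prod.snd (e_F x)) n o⟩, F, iso⟩

end Decomposition

end AInfinity

end

theorem theorem4p2_general {k : Type v} [Field k]
    {H : ℤ → Type u} [∀ d, AddCommGroup (H d)] [∀ d, Module k (H d)]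
    (X : AInfinity.AInfinityAlgebra k H) :
    ∃ (A B : ℤ → Type u)
      (_ : ∀ d, AddCommGroup (A d)) (_ : ∀ d, Module k (A d))
      (_ : ∀ d, AddCommGroup (B d)) (_ : ∀ d, Module k (B d))
      (M : AInfinity.AInfinityAlgebra k A) (L : AInfinity.AInfinityAlgebra k B)
      (S : AInfinity.AInfinityAlgebra k (fun d => A d × B d)),
      M.IsMinimal ∧ L.IsLinearContractible ∧ S.IsDirectSum M L ∧
        ∃ F : AInfinity.AInfinityMorphism X S, F.IsIso := by
  obtain ⟨A, B, _, _, _, _, h, p, i, b, j, C⟩ :=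
    AInfinity.exists_isSplitting X.hasDegree_differential X.differential_differential
  obtain ⟨M, q, hM, q_linear⟩ := X.exists_minimalModel C.toIsContraction C.hasDegree_h
    C.hasDegree_p C.hasDegree_i
  obtain ⟨L, r, hL, r_linear⟩ := X.exists_linearContractible_quotient C
  have bij : Function.Bijective (q.linearPart.prod r.linearPart) := by
    refine Function.bijective_iff_has_inverse.mpr ⟨i.coprod j, fun x => ?_, fun x => ?_⟩
    · simp [q_linear, r_linear, C.i_p_add_j_b]
    · simp [q_linear, r_linear, C.p_i, C.p_j, C.b_i, C.b_j]
  obtain ⟨S, hS, F, hF⟩ := AInfinity.AInfinityAlgebra.exists_isDirectSum_of_bijective q r bij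
  exact ⟨A, B, _, _, _, _, M, L, S, hM, hL, hS, F, hF⟩

theorem theorem4p2 {k : Type v} [Field k] [CharZero k]
    {H : ℤ → Type u} [∀ d, AddCommGroup (H d)] [∀ d, Module k (H d)]
    (X : AInfinity.AInfinityAlgebra k H) :
    ∃ (A B : ℤ → Type u)
      (_ : ∀ d, AddCommGroup (A d)) (_ : ∀ d, Module k (A d))
      (_ : ∀ d, AddCommGroup (B d)) (_ : ∀ d, Module k (B d))
      (M : AInfinity.AInfinityAlgebra k A) (L : AInfinity.AInfinityAlgebra k B)
      (S : AInfinity.AInfinityAlgebra k (fun d => A d × B d)),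
      M.IsMinimal ∧ L.IsLinearContractible ∧ S.IsDirectSum M L ∧
        ∃ F : AInfinity.AInfinityMorphism X S, F.IsIso :=
  theorem4p2_general X
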